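/- Fix $\lambda,\tau,\nu,\bar\rho>0$, put $a=\frac{\nu}{2\lambda^2\tau}$, and let $s>3$ be real. For $w=(\rho,q_1,q_2)$ with $\rho>0$ set $$A_1(w)=\Big(q_1,\tfrac{q_1^2}{\rho}+\rho-\bar\rho,\tfrac{q_1q_2}{\rho}\Big),\qquad A_2(w)=\Big(q_2,\tfrac{q_1q_2}{\rho},\tfrac{q_2^2}{\rho}+\rho-\bar\rho\Big),$$ $M_{1,3}(w)=aw\pm\frac{A_1(w)}{2\lambda}$, $M_{2,4}(w)=aw\pm\frac{A_2(w)}{2\lambda}$, $M_5(w)=(1-4a)w$. For $\varepsilon>0$ and $\mathbf u_0\in H^s(\mathbb T^2;\mathbb R^2)$ consider the vector BGK system for $f_1,\dots,f_5$ with values in $\mathbb R^3$, $$\partial_tf_l+\mathbf v_l\cdot\nabla f_l=\frac1{\tau\varepsilon^2}\big(M_l(\textstyle\sum_jf_j)-f_l\big),\qquad f_l(0,\cdot)=M_l(\bar\rho,\varepsilon\bar\rho\,\mathbf u_0),$$ where $\mathbf v_{1,3}=(\pm\lambda/\varepsilon,0)$, $\mathbf v_{2,4}=(0,\pm\lambda/\varepsilon)$,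 $\mathbf v_5=0$. Let $(f_l)$ be a solution in $C([0,T),H^s(\mathbb T^2))$, $0<T\le\infty$, with positive density (in particular, the maximal solution on $[0,T^\varepsilon)$). Write $\sum_lf_l=(\rho,\varepsilon\rho\mathbf u)$, $\bar w=(\bar\rho,0,0)$, and $$w=(\rho-\bar\rho,\varepsilon\rho\mathbf u),\quad m=\tfrac\lambda\varepsilon(f_1-f_3),\quad \xi=\tfrac\lambda\varepsilon(f_2-f_4),\quad k=f_1+f_3-2a\bar w,\quad h=f_2+f_4-2a\bar w,$$ and let $(\tilde w,\varepsilon^2\tilde m,\varepsilon^2\tilde\xi,\varepsilon^2\tilde k,\varepsilon^2\tilde h)=\Sigma^{-1}(w,\varepsilon^2m,\varepsilon^2\xi,\varepsilon^2k,\varepsilon^2h)$ with $$\Sigma=\begin{pmatrix}I&\varepsilon\sigma_1&\varepsilon\sigma_2&2a\varepsilon^2I&2a\varepsilon^2I\\ \varepsilon\sigma_1&2\lambda^2a\varepsilon^2I&0&\varepsilon^3\sigma_1&0\\ \varepsilon\sigma_2&0&2\lambda^2a\varepsilon^2I&0&\varepsilon^3\sigma_2\\ 2a\varepsilon^2I&\varepsilon^3\sigma_1&0&2a\varepsilon^4I&0\\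 2a\varepsilon^2I&0&\varepsilon^3\sigma_2&0&2a\varepsilon^4I\end{pmatrix},\quad \sigma_1=\begin{pmatrix}0&1&0\\1&0&0\\0&0&0\end{pmatrix},\quad \sigma_2=\begin{pmatrix}0&0&1\\0&0&0\\1&0&0\end{pmatrix}.$$ Assume that $0<a<\frac14$ and that, for some $\mu,\delta$ with $1<\mu<\frac1{4a}$ and $\delta>\max\big\{\frac2{1-4a\mu},\frac1{2a(1-1/\mu)}\big\}$, $$\lambda>\max\Big\{\sqrt{\tfrac\delta a},\sqrt{\tfrac{4a(1-4a)+1}{4a^2(1-4a)}}\Big\},\qquad \lambda>\sqrt{\frac{4+\frac1\tau+\frac1{a(1-4a)}}{4a}}.$$ Then there are a nondecreasing function $C:\mathbb R\to[0,\infty)$, depending only on $\lambda,\tau,\nu,\bar\rho,s$, and, for every $K$, a constant $c>0$, depending only on these parameters and $K$, such that for all $\varepsilon>0$ and $\mathbf u_0$ with $\varepsilon\|\mathbf u_0\|_s\le K$, all solutions as above and all $t\in[0,T)$: $\Sigma$ maps $(\tilde w,\varepsilon^2\tilde m,\varepsilon^2\tilde\xi,\varepsilon^2\tilde k,\varepsilon^2\tilde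 h)$ to $(w,\varepsilon^2m,\varepsilon^2\xi,\varepsilon^2k,\varepsilon^2h)$, $\mathbf u(r)\in H^s$ for $r\in[0,t]$ with $\|\mathbf u\|_{L^\infty([0,t],H^s)}=\sup_{0\le r\le t}\|\mathbf u(r)\|_s<\infty$, and $$\|w(t)\|_s^2+\varepsilon^6\big(\|\tilde m(t)\|_s^2+\|\tilde\xi(t)\|_s^2\big)+\varepsilon^8\big(\|\tilde k(t)\|_s^2+\|\tilde h(t)\|_s^2\big)\le c\,\varepsilon^2\|\mathbf u_0\|_s^2\,e^{C(\|\mathbf u\|_{L^\infty([0,t],H^s)})\,t},$$ $$\frac{\|\rho(t)-\bar\rho\|_s^2}{\varepsilon^2}+\|\rho\mathbf u(t)\|_s^2\le c\,\|\mathbf u_0\|_s^2\,e^{C(\|\mathbf u\|_{L^\infty([0,t],H^s)})\,t}.$$ -/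

import Mathlib

open scoped Topology

noncomputable section

namespace VectorBGK

/-! ### Sobolev spaces on the two-dimensional torus -/

/-- The two-dimensional torus `𝕋² = (ℝ/ℤ)²`. -/
abbrev Torus := UnitAddTorus (Fin 2)

/-- The `n`-th Fourier coefficient of a real function on the torus. -/
def fourierCoef (g : Torus → ℝ) (n : Fin 2 → ℤ) : ℂ :=
  UnitAddTorus.mFourierCoeff (fun x => (g x : ℂ)) n

/-- The Fourier weight `(1 + |2πn|²)^s`. -/
def sobolevWeight (s : ℝ) (n : Fin 2 → ℤ) : ℝ :=
  (1 + (2 * Real.pi) ^ 2 * ((n 0 : ℝ) ^ 2 + (n 1 : ℝ) ^ 2)) ^ s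

/-- Membership in `H^s(𝕋²)`. It is used only for `s > 3`, where every class has a unique continuous
representative; elements of `H^s` are identified with these. -/
def MemHs (s : ℝ) (g : Torus → ℝ) : Prop :=
  Continuous g ∧ Summable fun n => sobolevWeight s n * ‖fourierCoef g n‖ ^ 2

/-- The square `‖g‖_s²` of the `H^s` norm. -/
def hsNormSq (s : ℝ) (g : Torus → ℝ) : ℝ :=
  ∑' n, sobolevWeight s n * ‖fourierCoef g n‖ ^ 2

/-- Membership in `H^s(𝕋²)` for vector-valued functions, componentwise. -/
def MemHsVec {k : ℕ} (s : ℝ) (v : Torus → Fin k → ℝ) : Prop :=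
  ∀ j, MemHs s fun x => v x j

/-- `‖v‖_s²` for vector-valued `v`: the sum of the squares over the components. -/
def hsNormSqVec {k : ℕ} (s : ℝ) (v : Torus → Fin k → ℝ) : ℝ :=
  ∑ j, hsNormSq s fun x => v x j

/-- `‖v‖_s` for vector-valued `v`. -/
def hsNormVec {k : ℕ} (s : ℝ) (v : Torus → Fin k → ℝ) : ℝ :=
  Real.sqrt (hsNormSqVec s v)

/-- The partial derivative `∂_x` (`i = 0`) or `∂_y` (`i = 1`) on the torus. -/
def partialDeriv (i : Fin 2) (g : Torus → ℝ) (x : Torus) : ℝ :=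
  deriv (fun h : ℝ => g (x + Pi.single i (h : UnitAddCircle))) 0

/-! ### The five velocities vector BGK model -/

/-- The fixed parameters: the velocity `lam`, the relaxation parameter `tau`, the viscosity `nu`
and the reference density `rhoBar`. -/
structure Params where
  lam : ℝ
  tau : ℝ
  nu : ℝ
  rhoBar : ℝ

namespace Params

/-- `a = ν / (2 λ² τ)`. -/
def a (P : Params) : ℝ := P.nu / (2 * P.lam ^ 2 * P.tau)

/-- `w̄ = (ρ̄, 0, 0)`. -/
def wBar (P : Params) : Fin 3 → ℝ := ![P.rhoBar, 0, 0]

/-- All parameters are positive. -/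
def Pos (P : Params) : Prop := 0 < P.lam ∧ 0 < P.tau ∧ 0 < P.nu ∧ 0 < P.rhoBar

/-- The dissipation condition `0 < a < 1/4`. -/
def Dissipation (P : Params) : Prop := 0 < P.a ∧ P.a < 1 / 4

/-- The largeness condition on `λ`; `δ` and `μ` are the auxiliary constants entering it. -/
def LargeVelocity (P : Params) : Prop :=
  (∃ μ δ : ℝ, 1 < μ ∧ μ < 1 / (4 * P.a) ∧
    max (2 / (1 - 4 * P.a * μ)) (1 / (2 * P.a * (1 - 1 / μ))) < δ ∧
    max (Real.sqrt (δ / P.a))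
      (Real.sqrt ((4 * P.a * (1 - 4 * P.a) + 1) / (4 * P.a ^ 2 * (1 - 4 * P.a)))) < P.lam) ∧
  Real.sqrt ((4 + 1 / P.tau + 1 / (P.a * (1 - 4 * P.a))) / (4 * P.a)) < P.lam

end Params

/-- The flux `A₁(w)`, for `w = (ρ, q₁, q₂)`, with pressure `P(ρ) = ρ - ρ̄`. -/
def flux1 (P : Params) (w : Fin 3 → ℝ) : Fin 3 → ℝ :=
  ![w 1, w 1 ^ 2 / w 0 + (w 0 - P.rhoBar), w 1 * w 2 / w 0]

/-- The flux `A₂(w)`, for `w = (ρ, q₁, q₂)`. -/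
def flux2 (P : Params) (w : Fin 3 → ℝ) : Fin 3 → ℝ :=
  ![w 2, w 1 * w 2 / w 0, w 2 ^ 2 / w 0 + (w 0 - P.rhoBar)]

/-- The Maxwellians `M₁, …, M₅` (indexed from `0`). -/
def maxwellian (P : Params) (w : Fin 3 → ℝ) : Fin 5 → Fin 3 → ℝ :=
  ![P.a • w + (1 / (2 * P.lam)) • flux1 P w,
    P.a • w + (1 / (2 * P.lam)) • flux2 P w,
    P.a • w - (1 / (2 * P.lam)) • flux1 P w,
    P.a • w - (1 / (2 * P.lam)) • flux2 P w,
    (1 - 4 * P.a) • w]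

/-- The velocities `±λ/ε` along the two axes, and `0`. -/
def velocity (P : Params) (ε : ℝ) : Fin 5 → Fin 2 → ℝ :=
  ![![P.lam / ε, 0], ![0, P.lam / ε], ![-(P.lam / ε), 0], ![0, -(P.lam / ε)], ![0, 0]]

/-- The moment `(ρ, q₁, q₂) = ∑ₗ fₗ`. -/
def moment (F : Fin 5 → Fin 3 → ℝ) : Fin 3 → ℝ := ∑ l, F l

/-- The time interval `[0, T)`, where `T = ∞` is allowed. -/
def timeInterval (T : EReal) : Set ℝ := {t | 0 ≤ t ∧ (t : EReal) < T}

/-- `f = (f₁, …, f₅)` is a solution on `[0, T)`, of class `C([0, T); H^s)` with positive density,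
of the vector BGK model with initial data `fₗ(0) = Mₗ(ρ̄, ε ρ̄ u₀)`. At `t = 0` the time derivative
is the right derivative. -/
structure IsSolution (P : Params) (ε s : ℝ) (u₀ : Torus → Fin 2 → ℝ) (T : EReal)
    (f : ℝ → Torus → Fin 5 → Fin 3 → ℝ) : Prop where
  memHs : ∀ t ∈ timeInterval T, ∀ l, MemHsVec s fun x => f t x l
  continuous : ∀ t ∈ timeInterval T, ∀ l,
    Filter.Tendsto (fun r => hsNormVec s fun x => f r x l - f t x l)
      (𝓝[timeInterval T] t) (𝓝 0)
  density_pos : ∀ t ∈ timeInterval T, ∀ x, 0 < moment (f t x) 0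
  equation : ∀ t ∈ timeInterval T, ∀ x l j,
    HasDerivWithinAt (fun r => f r x l j)
      (1 / (P.tau * ε ^ 2) * (maxwellian P (moment (f t x)) l j - f t x l j)
        - ∑ i, velocity P ε l i * partialDeriv i (fun y => f t y l j) x)
      (timeInterval T) t
  initial : ∀ x l,
    f 0 x l = maxwellian P ![P.rhoBar, ε * P.rhoBar * u₀ x 0, ε * P.rhoBar * u₀ x 1] l

/-- The density `ρ`. -/
def density (F : Fin 5 → Fin 3 → ℝ) : ℝ := moment F 0

/-- The velocity `𝐮`, defined by `(q₁, q₂) = ε ρ 𝐮`. -/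
def vel (ε : ℝ) (F : Fin 5 → Fin 3 → ℝ) : Fin 2 → ℝ :=
  ![moment F 1 / (ε * density F), moment F 2 / (ε * density F)]

/-- The translated conservative state `W = (w, ε²m, ε²ξ, ε²k, ε²h)`, where
`w = ∑ₗ fₗ - w̄`, `m = (λ/ε)(f₁ - f₃)`, `ξ = (λ/ε)(f₂ - f₄)`, `k = f₁ + f₃ - 2a w̄` and
`h = f₂ + f₄ - 2a w̄`. -/
def state (P : Params) (ε : ℝ) (F : Fin 5 → Fin 3 → ℝ) : Fin 5 × Fin 3 → ℝ := fun p =>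
  (![moment F - P.wBar,
     ε ^ 2 • (P.lam / ε) • (F 0 - F 2),
     ε ^ 2 • (P.lam / ε) • (F 1 - F 3),
     ε ^ 2 • (F 0 + F 2 - (2 * P.a) • P.wBar),
     ε ^ 2 • (F 1 + F 3 - (2 * P.a) • P.wBar)] : Fin 5 → Fin 3 → ℝ) p.1 p.2

/-- The matrix `σ₁`. -/
def sigma1 : Matrix (Fin 3) (Fin 3) ℝ := !![0, 1, 0; 1, 0, 0; 0, 0, 0]

/-- The matrix `σ₂`. -/
def sigma2 : Matrix (Fin 3) (Fin 3) ℝ := !![0, 0, 1; 0, 0, 0; 1, 0, 0]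

/-- The `3 × 3` blocks of the symmetrizer. -/
def symmetrizerBlocks (P : Params) (ε : ℝ) :
    Matrix (Fin 5) (Fin 5) (Matrix (Fin 3) (Fin 3) ℝ) :=
  let b : Matrix (Fin 3) (Fin 3) ℝ := (2 * P.a * ε ^ 2) • 1
  let d : Matrix (Fin 3) (Fin 3) ℝ := (2 * P.lam ^ 2 * P.a * ε ^ 2) • 1
  let e : Matrix (Fin 3) (Fin 3) ℝ := (2 * P.a * ε ^ 4) • 1
  !![1, ε • sigma1, ε • sigma2, b, b;
     ε • sigma1, d, 0, ε ^ 3 • sigma1, 0;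
     ε • sigma2, 0, d, 0, ε ^ 3 • sigma2;
     b, ε ^ 3 • sigma1, 0, e, 0;
     b, 0, ε ^ 3 • sigma2, 0, e]

/-- The constant right symmetrizer `Σ`, a `15 × 15` matrix. -/
def symmetrizer (P : Params) (ε : ℝ) : Matrix (Fin 5 × Fin 3) (Fin 5 × Fin 3) ℝ :=
  Matrix.of fun p q => symmetrizerBlocks P ε p.1 q.1 p.2 q.2

/-- The symmetrized state `W̃ = (w̃, ε²m̃, ε²ξ̃, ε²k̃, ε²h̃) = Σ⁻¹ W`. -/
def symState (P : Params) (ε : ℝ) (F : Fin 5 → Fin 3 → ℝ) : Fin 5 × Fin 3 → ℝ :=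
  Matrix.mulVec (symmetrizer P ε)⁻¹ (state P ε F)

/-- The translated conservative variable `w = (ρ - ρ̄, ε ρ 𝐮)`. -/
def wVar (P : Params) (ε : ℝ) (F : Fin 5 → Fin 3 → ℝ) : Fin 3 → ℝ :=
  fun j => state P ε F (0, j)

/-- The symmetrized variable `m̃`. -/
def mTilde (P : Params) (ε : ℝ) (F : Fin 5 → Fin 3 → ℝ) : Fin 3 → ℝ :=
  fun j => symState P ε F (1, j) / ε ^ 2

/-- The symmetrized variable `ξ̃`. -/
def xiTilde (P : Params) (ε : ℝ) (F : Fin 5 → Fin 3 → ℝ) : Fin 3 → ℝ :=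
  fun j => symState P ε F (2, j) / ε ^ 2

/-- The symmetrized variable `k̃`. -/
def kTilde (P : Params) (ε : ℝ) (F : Fin 5 → Fin 3 → ℝ) : Fin 3 → ℝ :=
  fun j => symState P ε F (3, j) / ε ^ 2

/-- The symmetrized variable `h̃`. -/
def hTilde (P : Params) (ε : ℝ) (F : Fin 5 → Fin 3 → ℝ) : Fin 3 → ℝ :=
  fun j => symState P ε F (4, j) / ε ^ 2

/-- The set of values `‖𝐮(r)‖_s` for `r ∈ [0, t]`. -/
def velNorms (ε s : ℝ) (f : ℝ → Torus → Fin 5 → Fin 3 → ℝ) (t : ℝ) : Set ℝ :=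
  (fun r => hsNormVec s fun x => vel ε (f r x)) '' Set.Icc 0 t

/-- The norm `‖𝐮‖_{L^∞([0, t], H^s)}`; as `𝐮` is continuous in time with values in `H^s`, it is a
supremum. -/
def velSup (ε s : ℝ) (f : ℝ → Torus → Fin 5 → Fin 3 → ℝ) (t : ℝ) : ℝ :=
  sSup (velNorms ε s f t)

end VectorBGK

end

/-! The pressure is affine in the density, so about the rest state each Maxwellian is exactly a
constant symmetric matrix `linMat l` applied to w plus a term `quadFlux` made of products q_i q_k /
ρ. The fluctuations G_l of the populations about the reference equilibrium therefore solve a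
constant-coefficient linear BGK system with source N = `quadFlux`, whose sum over l is zero. The
condition on λ gives 1/(2λ) < a, which makes all the matrices L_l = `linMat l` positive definite.

For the linear system, Σ_l ⟨G_l, L_l⁻¹ G_l⟩ is an entropy. In Fourier variables transport is a
scalar phase on each population, so it contributes nothing. Relaxation conserves the moment, and the
entropy it produces is at most a quarter of the entropy of N (`entropy_production_le`). No
commutator arises, since all coefficients are constant, and the source contains no derivative.

The source is small: q_i q_k / ρ = ε u_i q_k, and q_k is linear in G. By the algebra property of
H^s, ‖N‖_s² is at most a constant times ε² ‖u‖_s² ‖G‖_s². The factor ε² cancels the relaxation rate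
1/(τε²), so the Grönwall exponent (`energy_estimate`) is uniform in ε. At time 0, the fluctuation is
ε times a linear term in u₀ plus ε² times a quadratic one, which is controlled using ε‖u₀‖_s ≤ K.

The symmetrizer enters only at the end. With S = `fluctState`, the map from fluctuations to W, one
has Σ = S diag(L_l) Sᵀ. Hence Σ⁻¹W consists of ε-independent combinations of the L_l⁻¹ G_l
multiplied by explicit powers of ε, and these powers are exactly the weights in the estimate. -/

namespace VectorBGK

open scoped Topology

open MeasureTheory UnitAddTorus

/-! ### Fourier coefficients on the torus -/

/-- The Haar probability measure on the torus. -/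
noncomputable def torusMeasure : Measure Torus := Measure.pi fun _ => AddCircle.haarAddCircle

instance : IsProbabilityMeasure torusMeasure := by
  unfold torusMeasure; infer_instance

instance : torusMeasure.IsAddLeftInvariant := by
  unfold torusMeasure; infer_instance

theorem integrable_torus {E : Type*} [NormedAddCommGroup E] {f : Torus → E} (hf : Continuous f) :
    Integrable f torusMeasure :=
  hf.integrable_of_hasCompactSupport (HasCompactSupport.of_compactSpace f)

theorem norm_mFourier_apply (n : Fin 2 → ℤ) (x : Torus) : ‖mFourier n x‖ = 1 := by
  simp only [mFourier, ContinuousMap.coe_mk, norm_prod, fourier_apply, Circle.norm_coe,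
    Finset.prod_const_one]

theorem fourierCoef_eq_integral (g : Torus → ℝ) (n : Fin 2 → ℤ) :
    fourierCoef g n = ∫ x, mFourier (-n) x * (g x : ℂ) ∂torusMeasure := rfl

theorem continuous_mFourier_mul {g : Torus → ℝ} (hg : Continuous g) (n : Fin 2 → ℤ) :
    Continuous fun x => mFourier n x * (g x : ℂ) :=
  (mFourier n).continuous.mul (Complex.continuous_ofReal.comp hg)

theorem fourierCoef_add {f g : Torus → ℝ} (hf : Continuous f) (hg : Continuous g)
    (n : Fin 2 → ℤ) : fourierCoef (fun x => f x + g x) n = fourierCoef f n + fourierCoef g n := by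
  simp only [fourierCoef_eq_integral, Complex.ofReal_add, mul_add]
  exact integral_add (integrable_torus (continuous_mFourier_mul hf _))
    (integrable_torus (continuous_mFourier_mul hg _))

theorem fourierCoef_const_mul (c : ℝ) (f : Torus → ℝ) (n : Fin 2 → ℤ) :
    fourierCoef (fun x => c * f x) n = c * fourierCoef f n := by
  simp only [fourierCoef_eq_integral, ← integral_const_mul]
  congr 1; ext x; push_cast; ring

theorem fourierCoef_sub {f g : Torus → ℝ} (hf : Continuous f) (hg : Continuous g)
    (n : Fin 2 → ℤ) : fourierCoef (fun x => f x - g x) n = fourierCoef f n - fourierCoef g n := by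
  have := fourierCoef_add (g := fun x => -1 * g x) hf (continuous_const.mul hg) n
  rw [fourierCoef_const_mul] at this
  convert this using 2
  · ext x; ring
  · push_cast; ring

theorem mFourierCoeff_one (n : Fin 2 → ℤ) :
    mFourierCoeff (fun _ : Torus => (1 : ℂ)) n = if n = 0 then 1 else 0 := by
  have h := (orthonormal_iff_ite (𝕜 := ℂ)).1 (orthonormal_mFourier (d := Fin 2)) n 0
  rw [ContinuousMap.inner_toLp] at h
  rw [← h]
  unfold mFourierCoeff
  congr 1; ext x
  rw [mFourier_neg, mFourier_zero]
  simp

theorem fourierCoef_const (c : ℝ) (n : Fin 2 → ℤ) :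
    fourierCoef (fun _ => c) n = if n = 0 then (c : ℂ) else 0 := by
  have := fourierCoef_const_mul c (fun _ => 1) n
  simp only [mul_one] at this
  rw [this, fourierCoef]
  simp only [Complex.ofReal_one, mFourierCoeff_one]
  split_ifs <;> simp

theorem summable_sq_fourierCoef {g : Torus → ℝ} (hg : Continuous g) :
    Summable fun n => ‖fourierCoef g n‖ ^ 2 := by
  let G : C(Torus, ℂ) := ⟨fun x => (g x : ℂ), Complex.continuous_ofReal.comp hg⟩
  have h1 := (hasSum_sq_mFourierCoeff (ContinuousMap.toLp 2 torusMeasure ℂ G)).summable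
  have h2 : ∀ n, mFourierCoeff (ContinuousMap.toLp 2 torusMeasure ℂ G) n = mFourierCoeff G n :=
    fun n => mFourierCoeff_toLp G n
  exact h1.congr fun n => congrArg (fun z : ℂ => ‖z‖ ^ 2) (h2 n)

/-! ### Sobolev weights -/

theorem one_le_sobolevBase (n : Fin 2 → ℤ) :
    1 ≤ 1 + (2 * Real.pi) ^ 2 * ((n 0 : ℝ) ^ 2 + (n 1 : ℝ) ^ 2) := by
  have : 0 ≤ (2 * Real.pi) ^ 2 * ((n 0 : ℝ) ^ 2 + (n 1 : ℝ) ^ 2) := by positivity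
  linarith

theorem sobolevWeight_pos (s : ℝ) (n : Fin 2 → ℤ) : 0 < sobolevWeight s n :=
  Real.rpow_pos_of_pos (by linarith [one_le_sobolevBase n]) _

theorem one_le_sobolevWeight {s : ℝ} (hs : 0 ≤ s) (n : Fin 2 → ℤ) : 1 ≤ sobolevWeight s n :=
  Real.one_le_rpow (one_le_sobolevBase n) hs

theorem sobolevWeight_mono {r s : ℝ} (h : r ≤ s) (n : Fin 2 → ℤ) :
    sobolevWeight r n ≤ sobolevWeight s n :=
  Real.rpow_le_rpow_of_exponent_le (one_le_sobolevBase n) h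

theorem sobolevWeight_add (r s : ℝ) (n : Fin 2 → ℤ) :
    sobolevWeight (r + s) n = sobolevWeight r n * sobolevWeight s n :=
  Real.rpow_add (by linarith [one_le_sobolevBase n]) _ _

theorem sobolevWeight_zero (n : Fin 2 → ℤ) : sobolevWeight 0 n = 1 := Real.rpow_zero _

theorem sobolevWeight_one (n : Fin 2 → ℤ) :
    sobolevWeight 1 n = 1 + (2 * Real.pi) ^ 2 * ((n 0 : ℝ) ^ 2 + (n 1 : ℝ) ^ 2) :=
  Real.rpow_one _

theorem sobolevWeight_mul_neg (s : ℝ) (n : Fin 2 → ℤ) :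
    sobolevWeight s n * sobolevWeight (-s) n = 1 := by
  rw [← sobolevWeight_add, add_neg_cancel, sobolevWeight_zero]

theorem summable_sobolevWeight_neg {s : ℝ} (hs : 1 < s) :
    Summable fun n => sobolevWeight (-s) n := by
  have h := EisensteinSeries.summable_one_div_norm_rpow (k := 2 * s) (by linarith)
  -- At n = 0 the comparison series takes the value 0 while the weight is 1; the added indicator of
  -- 0 makes up for this.
  refine Summable.of_nonneg_of_le (fun n => (sobolevWeight_pos _ n).le) (fun n => ?_)
    (h.add (hasSum_ite_eq (0 : Fin 2 → ℤ) (1 : ℝ)).summable)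
  by_cases hn : n = 0
  · subst hn
    simp [sobolevWeight, Real.zero_rpow (by linarith : -(2 * s) ≠ 0)]
  · have hpos : 0 < ‖n‖ := norm_pos_iff.2 hn
    have hle : ‖n‖ ^ 2 ≤ 1 + (2 * Real.pi) ^ 2 * ((n 0 : ℝ) ^ 2 + (n 1 : ℝ) ^ 2) := by
      have h1 : ‖n‖ ≤ √((n 0 : ℝ) ^ 2 + (n 1 : ℝ) ^ 2) := by
        refine (pi_norm_le_iff_of_nonneg (Real.sqrt_nonneg _)).2 fun i => ?_
        rw [Int.norm_eq_abs]
        apply Real.abs_le_sqrt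
        fin_cases i <;> simp <;> positivity
      have h2 : ‖n‖ ^ 2 ≤ (n 0 : ℝ) ^ 2 + (n 1 : ℝ) ^ 2 :=
        (Real.le_sqrt' hpos).1 h1
      have h3 : 1 ≤ (2 * Real.pi) ^ 2 := by nlinarith [Real.pi_gt_three]
      nlinarith [sq_nonneg (n 0 : ℝ), sq_nonneg (n 1 : ℝ)]
    simp only [hn, if_false, add_zero]
    calc sobolevWeight (-s) n ≤ (‖n‖ ^ 2) ^ (-s) :=
          Real.rpow_le_rpow_of_nonpos (by positivity) hle (by linarith)
      _ = ‖n‖ ^ (-(2 * s)) := by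
          rw [← Real.rpow_natCast, ← Real.rpow_mul (norm_nonneg _)]; congr 1; push_cast; ring

/-- From |n|² ≤ 2(|m|² + |n - m|²) the base is at most four times the larger of the other two bases;
then take s-th powers. In a convolution this moves the weight onto one of the two factors. -/
theorem sobolevWeight_le_add {s : ℝ} (hs : 0 ≤ s) (n m : Fin 2 → ℤ) :
    sobolevWeight s n ≤ 4 ^ s * (sobolevWeight s m + sobolevWeight s (n - m)) := by
  have key : ∀ x y z : ℝ, 1 ≤ x → 1 ≤ y → 1 ≤ z → x ≤ 2 * (y + z) →
      x ^ s ≤ 4 ^ s * (y ^ s + z ^ s) := by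
    intro x y z hx hy hz h
    have h1 : x ≤ 4 * max y z := by
      linarith [le_max_left y z, le_max_right y z]
    calc x ^ s ≤ (4 * max y z) ^ s := Real.rpow_le_rpow (by linarith) h1 hs
      _ = 4 ^ s * (max y z) ^ s :=
          Real.mul_rpow (by norm_num) (le_trans (by linarith) (le_max_left y z))
      _ ≤ 4 ^ s * (y ^ s + z ^ s) := by
          refine mul_le_mul_of_nonneg_left ?_ (by positivity)
          rcases max_cases y z with ⟨h, _⟩ | ⟨h, _⟩ <;> rw [h]
          · linarith [Real.rpow_nonneg (by linarith : 0 ≤ z) s]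
          · linarith [Real.rpow_nonneg (by linarith : 0 ≤ y) s]
  refine key _ _ _ (one_le_sobolevBase n) (one_le_sobolevBase m) (one_le_sobolevBase (n - m)) ?_
  have hp : ∀ a b : ℝ, a ^ 2 ≤ 2 * (b ^ 2 + (a - b) ^ 2) := fun a b => by
    nlinarith [sq_nonneg (a - 2 * b)]
  have h0 := hp (n 0) (m 0)
  have h1 := hp (n 1) (m 1)
  simp only [Pi.sub_apply, Int.cast_sub]
  have := mul_le_mul_of_nonneg_left (add_le_add h0 h1) (sq_nonneg (2 * Real.pi))
  nlinarith

/-! ### Elementary properties of Sobolev spaces -/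

theorem hsNormSq_nonneg (s : ℝ) (g : Torus → ℝ) : 0 ≤ hsNormSq s g :=
  tsum_nonneg fun n => mul_nonneg (sobolevWeight_pos s n).le (sq_nonneg _)

theorem hsNormSqVec_nonneg {k : ℕ} (s : ℝ) (v : Torus → Fin k → ℝ) : 0 ≤ hsNormSqVec s v :=
  Finset.sum_nonneg fun _ _ => hsNormSq_nonneg _ _

theorem hsNormVec_nonneg {k : ℕ} (s : ℝ) (v : Torus → Fin k → ℝ) : 0 ≤ hsNormVec s v :=
  Real.sqrt_nonneg _

theorem sq_hsNormVec {k : ℕ} (s : ℝ) (v : Torus → Fin k → ℝ) :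
    hsNormVec s v ^ 2 = hsNormSqVec s v := Real.sq_sqrt (hsNormSqVec_nonneg s v)

theorem hsNormSq_le_vec {k : ℕ} (s : ℝ) (v : Torus → Fin k → ℝ) (j : Fin k) :
    hsNormSq s (fun x => v x j) ≤ hsNormSqVec s v :=
  Finset.single_le_sum (f := fun j => hsNormSq s fun x => v x j)
    (fun _ _ => hsNormSq_nonneg _ _) (Finset.mem_univ j)

theorem memHs_of_le {s : ℝ} {f : Torus → ℝ} {b : (Fin 2 → ℤ) → ℝ} (hf : Continuous f)
    (hb : Summable b) (h : ∀ n, sobolevWeight s n * ‖fourierCoef f n‖ ^ 2 ≤ b n) :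
    MemHs s f ∧ hsNormSq s f ≤ ∑' n, b n := by
  have : Summable fun n => sobolevWeight s n * ‖fourierCoef f n‖ ^ 2 :=
    .of_nonneg_of_le (fun n => mul_nonneg (sobolevWeight_pos s n).le (sq_nonneg _)) h hb
  exact ⟨⟨hf, this⟩, this.tsum_le_tsum h hb⟩

theorem MemHs.mono {r s : ℝ} {f : Torus → ℝ} (hf : MemHs s f) (h : r ≤ s) : MemHs r f :=
  (memHs_of_le hf.1 hf.2 fun n =>
    mul_le_mul_of_nonneg_right (sobolevWeight_mono h n) (sq_nonneg _)).1

theorem memHs_zero_of_continuous {f : Torus → ℝ} (hf : Continuous f) : MemHs 0 f :=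
  ⟨hf, by simpa [sobolevWeight_zero] using summable_sq_fourierCoef hf⟩

theorem memHs_const (s c : ℝ) : MemHs s fun _ => c := by
  refine ⟨continuous_const, summable_of_ne_finset_zero (s := {0}) fun n hn => ?_⟩
  rw [fourierCoef_const, if_neg (by simpa using hn)]
  simp

theorem MemHs.const_mul {s : ℝ} {f : Torus → ℝ} (hf : MemHs s f) (c : ℝ) :
    MemHs s fun x => c * f x := by
  refine (memHs_of_le (f := fun x => c * f x) (continuous_const.mul hf.1)
    (hf.2.mul_left (c ^ 2)) fun n => le_of_eq ?_).1
  simp only [fourierCoef_const_mul, norm_mul, Complex.norm_real, Real.norm_eq_abs, mul_pow, sq_abs]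
  ring

theorem hsNormSq_const_mul (s c : ℝ) (f : Torus → ℝ) :
    hsNormSq s (fun x => c * f x) = c ^ 2 * hsNormSq s f := by
  unfold hsNormSq
  rw [← tsum_mul_left]
  congr 1; ext n
  simp only [fourierCoef_const_mul, norm_mul, Complex.norm_real, Real.norm_eq_abs, mul_pow, sq_abs]
  ring

theorem MemHs.add_and_le {s : ℝ} {f g : Torus → ℝ} (hf : MemHs s f) (hg : MemHs s g) :
    MemHs s (fun x => f x + g x) ∧
      hsNormSq s (fun x => f x + g x) ≤ 2 * hsNormSq s f + 2 * hsNormSq s g := by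
  have := memHs_of_le (s := s) (f := fun x => f x + g x) (hf.1.add hg.1) ((hf.2.mul_left 2).add (hg.2.mul_left 2))
    fun n => by
      have h1 : ‖fourierCoef f n + fourierCoef g n‖ ^ 2
          ≤ 2 * ‖fourierCoef f n‖ ^ 2 + 2 * ‖fourierCoef g n‖ ^ 2 := by
        have h2 := norm_add_le (fourierCoef f n) (fourierCoef g n)
        have h3 := norm_nonneg (fourierCoef f n + fourierCoef g n)
        nlinarith [sq_nonneg (‖fourierCoef f n‖ - ‖fourierCoef g n‖)]
      have h4 := mul_le_mul_of_nonneg_left h1 (sobolevWeight_pos s n).le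
      rw [fourierCoef_add hf.1 hg.1 n]
      linarith
  rw [(hf.2.mul_left 2).tsum_add (hg.2.mul_left 2), tsum_mul_left, tsum_mul_left] at this
  exact this

theorem MemHs.add {s : ℝ} {f g : Torus → ℝ} (hf : MemHs s f) (hg : MemHs s g) :
    MemHs s (fun x => f x + g x) := (hf.add_and_le hg).1

theorem MemHs.sub {s : ℝ} {f g : Torus → ℝ} (hf : MemHs s f) (hg : MemHs s g) :
    MemHs s (fun x => f x - g x) := by
  simpa [sub_eq_add_neg] using hf.add (hg.const_mul (-1))

theorem hsNormSq_sub_le {s : ℝ} {f g : Torus → ℝ} (hf : MemHs s f) (hg : MemHs s g) :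
    hsNormSq s (fun x => f x - g x) ≤ 2 * hsNormSq s f + 2 * hsNormSq s g := by
  have := (hf.add_and_le (hg.const_mul (-1))).2
  rw [hsNormSq_const_mul] at this
  simpa [sub_eq_add_neg] using this

theorem MemHs.sum {s : ℝ} {ι : Type*} (t : Finset ι) {f : ι → Torus → ℝ}
    (hf : ∀ i ∈ t, MemHs s (f i)) : MemHs s fun x => ∑ i ∈ t, f i x := by
  classical
  induction t using Finset.induction_on with
  | empty => simpa using memHs_const s 0
  | insert i t hi ih =>
    simp only [Finset.sum_insert hi]
    exact (hf i (Finset.mem_insert_self i t)).add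
      (ih fun j hj => hf j (Finset.mem_insert_of_mem hj))

theorem sum_weight_le_hsNormSq {s : ℝ} {f : Torus → ℝ} (hf : MemHs s f)
    (S : Finset (Fin 2 → ℤ)) :
    ∑ n ∈ S, sobolevWeight s n * ‖fourierCoef f n‖ ^ 2 ≤ hsNormSq s f :=
  hf.2.sum_le_tsum S fun n _ => mul_nonneg (sobolevWeight_pos s n).le (sq_nonneg _)

theorem sq_norm_fourierCoef_le {s : ℝ} (hs : 0 ≤ s) {f : Torus → ℝ} (hf : MemHs s f)
    (n : Fin 2 → ℤ) : ‖fourierCoef f n‖ ^ 2 ≤ hsNormSq s f := by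
  have h := sum_weight_le_hsNormSq hf {n}
  rw [Finset.sum_singleton] at h
  nlinarith [one_le_sobolevWeight hs n, sq_nonneg ‖fourierCoef f n‖]

/-! ### Absolutely convergent Fourier series -/

/-- Split the weight of order r/2 into orders s/2 and -(s - r)/2 and use xy ≤ x² + y². The resulting
sup bounds are not homogeneous in f, which is harmless: they serve only for convergence and
domination. -/
theorem weight_mul_fourierCoef_le (s r : ℝ) (f : Torus → ℝ) (n : Fin 2 → ℤ) :
    sobolevWeight (r / 2) n * ‖fourierCoef f n‖
      ≤ sobolevWeight s n * ‖fourierCoef f n‖ ^ 2 + sobolevWeight (-(s - r)) n := by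
  have h1 : sobolevWeight (r / 2) n
      = sobolevWeight (s / 2) n * sobolevWeight (-(s - r) / 2) n := by
    rw [← sobolevWeight_add]; congr 1; ring
  have h2 : sobolevWeight s n = sobolevWeight (s / 2) n ^ 2 := by
    rw [sq, ← sobolevWeight_add]; congr 1; ring
  have h3 : sobolevWeight (-(s - r)) n = sobolevWeight (-(s - r) / 2) n ^ 2 := by
    rw [sq, ← sobolevWeight_add]; congr 1; ring
  rw [h1, h2, h3]
  have := sobolevWeight_pos (s / 2) n
  have := sobolevWeight_pos (-(s - r) / 2) n
  have := norm_nonneg (fourierCoef f n)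
  nlinarith [sq_nonneg (sobolevWeight (s / 2) n * ‖fourierCoef f n‖ -
    sobolevWeight (-(s - r) / 2) n), mul_nonneg (mul_nonneg (sobolevWeight_pos (s / 2) n).le this)
    (sobolevWeight_pos (-(s - r) / 2) n).le]

theorem MemHs.summable_weight_mul {s r : ℝ} {f : Torus → ℝ} (hf : MemHs s f) (h : 1 + r < s) :
    Summable fun n => sobolevWeight (r / 2) n * ‖fourierCoef f n‖ :=
  .of_nonneg_of_le (fun n => mul_nonneg (sobolevWeight_pos _ n).le (norm_nonneg _))
    (weight_mul_fourierCoef_le s r f)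
    (hf.2.add (summable_sobolevWeight_neg (by linarith)))

theorem MemHs.tsum_weight_mul_le {s r : ℝ} {f : Torus → ℝ} (hf : MemHs s f) (h : 1 + r < s) :
    ∑' n, sobolevWeight (r / 2) n * ‖fourierCoef f n‖
      ≤ hsNormSq s f + ∑' n, sobolevWeight (-(s - r)) n := by
  have h2 := summable_sobolevWeight_neg (s := s - r) (by linarith)
  refine ((hf.summable_weight_mul h).tsum_le_tsum (weight_mul_fourierCoef_le s r f)
    (hf.2.add h2)).trans (le_of_eq ?_)
  exact hf.2.tsum_add h2

theorem MemHs.summable_norm {s : ℝ} (hs : 1 < s) {f : Torus → ℝ} (hf : MemHs s f) :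
    Summable fun n => ‖fourierCoef f n‖ := by
  simpa [sobolevWeight_zero] using hf.summable_weight_mul (r := 0) (by linarith)

theorem MemHs.hasSum_fourier {s : ℝ} (hs : 1 < s) {f : Torus → ℝ} (hf : MemHs s f) (x : Torus) :
    HasSum (fun n => fourierCoef f n * mFourier n x) (f x : ℂ) :=
  hasSum_mFourier_series_apply_of_summable
    (f := ⟨fun x => (f x : ℂ), Complex.continuous_ofReal.comp hf.1⟩)
    (.of_norm (hf.summable_norm hs)) x

theorem MemHs.abs_le {s : ℝ} (hs : 1 < s) {f : Torus → ℝ} (hf : MemHs s f) (x : Torus) :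
    |f x| ≤ hsNormSq s f + ∑' n, sobolevWeight (-s) n := by
  have h1 := hf.summable_norm hs
  have h2 := hf.tsum_weight_mul_le (r := 0) (by linarith)
  simp only [zero_div, sobolevWeight_zero, one_mul, sub_zero] at h2
  refine le_trans ?_ h2
  rw [← Real.norm_eq_abs, ← Complex.norm_real, ← (hf.hasSum_fourier hs x).tsum_eq]
  refine (norm_tsum_le_tsum_norm ?_).trans (le_of_eq ?_)
  · simpa [norm_mFourier_apply] using h1
  · simp [norm_mFourier_apply]

/-! ### The algebra property -/

/-- Insert the absolutely convergent Fourier series of f under the integral and exchange sum and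
integral; g need only be bounded. -/
theorem hasSum_fourierCoef_mul {s : ℝ} (hs : 1 < s) {f g : Torus → ℝ} (hf : MemHs s f)
    (hg : Continuous g) (n : Fin 2 → ℤ) :
    HasSum (fun m => fourierCoef f m * fourierCoef g (n - m)) (fourierCoef (fun x => f x * g x) n) := by
  have hcont : ∀ m, Continuous fun x => fourierCoef f m * (mFourier (-(n - m)) x * (g x : ℂ)) :=
    fun m => continuous_const.mul (continuous_mFourier_mul hg _)
  obtain ⟨B, hB⟩ : ∃ B, ∀ x, |g x| ≤ B := by
    obtain ⟨B, hB⟩ := isCompact_univ.exists_bound_of_continuousOn hg.continuousOn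
    exact ⟨B, fun x => hB x trivial⟩
  have hF := hasSum_integral_of_summable_integral_norm (μ := torusMeasure)
    (F := fun m x => fourierCoef f m * (mFourier (-(n - m)) x * (g x : ℂ)))
    (fun m => integrable_torus (hcont m)) (by
      refine .of_nonneg_of_le (fun m => integral_nonneg fun x => norm_nonneg _) (fun m => ?_)
        ((hf.summable_norm hs).mul_right B)
      have := norm_integral_le_of_norm_le_const (μ := torusMeasure)
        (f := fun x => ‖fourierCoef f m * (mFourier (-(n - m)) x * (g x : ℂ))‖)
        (C := ‖fourierCoef f m‖ * B) (.of_forall fun x => by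
          simpa [norm_mFourier_apply] using
            mul_le_mul_of_nonneg_left (hB x) (norm_nonneg (fourierCoef f m)))
      simpa using (le_abs_self _).trans this)
  simp only [integral_const_mul, ← fourierCoef_eq_integral] at hF
  have hint : fourierCoef (fun x => f x * g x) n = ∫ x, ∑' m, fourierCoef f m *
      (mFourier (-(n - m)) x * (g x : ℂ)) ∂torusMeasure := by
    rw [fourierCoef_eq_integral]
    congr 1; ext x
    have h := ((hf.hasSum_fourier hs x).mul_right (mFourier (-n) x * (g x : ℂ))).tsum_eq
    rw [Complex.ofReal_mul, mul_left_comm, ← h]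
    refine tsum_congr fun m => ?_
    rw [show -(n - m) = m + -n by abel, mFourier_add]
    ring
  rw [hint]
  exact hF

theorem summable_and_sq_tsum_le {ι : Type*} {x p q : ι → ℝ} (hx : ∀ i, 0 ≤ x i)
    (hp : ∀ i, 0 ≤ p i) (hq : ∀ i, 0 ≤ q i) (h : ∀ i, x i ^ 2 ≤ p i * q i) (sp : Summable p)
    (sq' : Summable q) : Summable x ∧ (∑' i, x i) ^ 2 ≤ (∑' i, p i) * ∑' i, q i := by
  have hP : 0 ≤ ∑' i, p i := tsum_nonneg hp
  have hQ : 0 ≤ ∑' i, q i := tsum_nonneg hq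
  have hfin : ∀ u : Finset ι, ∑ i ∈ u, x i ≤ √((∑' i, p i) * ∑' i, q i) := fun u => by
    apply Real.le_sqrt_of_sq_le
    refine (Finset.sum_sq_le_sum_mul_sum_of_sq_le_mul u (fun i _ => hp i) (fun i _ => hq i)
      fun i _ => h i).trans ?_
    exact mul_le_mul (sp.sum_le_tsum u fun i _ => hp i) (sq'.sum_le_tsum u fun i _ => hq i)
      (Finset.sum_nonneg fun i _ => hq i) hP
  refine ⟨summable_of_sum_le hx hfin, ?_⟩
  have := Real.tsum_le_of_sum_le hx hfin
  calc (∑' i, x i) ^ 2 ≤ √((∑' i, p i) * ∑' i, q i) ^ 2 :=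
        pow_le_pow_left₀ (tsum_nonneg hx) this 2
    _ = _ := Real.sq_sqrt (mul_nonneg hP hQ)

/-- Tonelli for nonnegative families, through the bijection (n, m) ↦ (m, n - m). -/
theorem summable_convolution {ι : Type*} [AddCommGroup ι] {F G : ι → ℝ} (hF0 : ∀ n, 0 ≤ F n) (hG0 : ∀ n, 0 ≤ G n)
    (hF : Summable F) (hG : Summable G) :
    (∀ n, Summable fun m => F m * G (n - m)) ∧ (Summable fun n => ∑' m, F m * G (n - m)) ∧
      ∑' n, ∑' m, F m * G (n - m) = (∑' n, F n) * ∑' n, G n := by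
  obtain ⟨e, he⟩ : ∃ e : ι × ι ≃ ι × ι, ∀ p, e p = (p.2, p.1 - p.2) :=
    ⟨{  toFun := fun p => (p.2, p.1 - p.2)
        invFun := fun p => (p.1 + p.2, p.1)
        left_inv := fun p => by simp
        right_inv := fun p => by simp }, fun _ => rfl⟩
  have hFG : Summable fun p : ι × ι => F p.1 * G p.2 :=
    Summable.mul_of_nonneg hF hG hF0 hG0
  have hFG' : Summable fun p : ι × ι => F p.2 * G (p.1 - p.2) :=
    (e.summable_iff.2 hFG).congr fun p => by simp [he]
  refine ⟨fun n => hFG'.prod_factor n, hFG'.prod, ?_⟩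
  rw [hF.tsum_mul_tsum hG hFG, ← e.tsum_eq, ← hFG'.tsum_prod (f := fun p => F p.2 * G (p.1 - p.2))]
  simp only [he]

/-- After `sobolevWeight_le_add`, one of the two reciprocal weights cancels in each term, and what
remains is summable with a sum independent of n. -/
theorem sobolevWeight_mul_convolution_le {s : ℝ} (hs : 1 < s) (n : Fin 2 → ℤ) :
    Summable (fun m => sobolevWeight (-s) m * sobolevWeight (-s) (n - m)) ∧
      sobolevWeight s n * ∑' m, sobolevWeight (-s) m * sobolevWeight (-s) (n - m)
        ≤ 4 ^ s * (2 * ∑' m, sobolevWeight (-s) m) := by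
  have hA := summable_sobolevWeight_neg hs
  have hsub : Summable fun m => sobolevWeight (-s) (n - m) :=
    (Equiv.subLeft n).summable_iff (f := fun m => sobolevWeight (-s) m) |>.2 hA
  have hle : ∀ m, sobolevWeight s n * (sobolevWeight (-s) m * sobolevWeight (-s) (n - m))
      ≤ 4 ^ s * (sobolevWeight (-s) (n - m) + sobolevWeight (-s) m) := fun m => by
    have h1 := sobolevWeight_le_add (by linarith : 0 ≤ s) n m
    have h2 := sobolevWeight_mul_neg s m
    have h3 := sobolevWeight_mul_neg s (n - m)
    have h4 := mul_pos (sobolevWeight_pos (-s) m) (sobolevWeight_pos (-s) (n - m))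
    refine (mul_le_mul_of_nonneg_right h1 h4.le).trans (le_of_eq ?_)
    linear_combination (4 ^ s * sobolevWeight (-s) (n - m)) * h2
      + (4 ^ s * sobolevWeight (-s) m) * h3
  have hS := (hsub.add hA).mul_left ((4 : ℝ) ^ s)
  have hS' := Summable.of_nonneg_of_le (fun m => mul_nonneg (sobolevWeight_pos s n).le
    (mul_pos (sobolevWeight_pos (-s) m) (sobolevWeight_pos (-s) (n - m))).le) hle hS
  refine ⟨(summable_mul_left_iff (sobolevWeight_pos s n).ne').1 hS', ?_⟩
  rw [← tsum_mul_left]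
  refine (hS'.tsum_le_tsum hle hS).trans (le_of_eq ?_)
  rw [tsum_mul_left, hsub.tsum_add hA,
    show ∑' m, sobolevWeight (-s) (n - m) = _ from
      (Equiv.subLeft n).tsum_eq fun m => sobolevWeight (-s) m]
  ring

/-- Cauchy–Schwarz in the convolution, with the weights of m and n - m inserted in one factor and
their reciprocals in the other. -/
theorem sobolevWeight_mul_sq_fourierCoef_mul_le {s : ℝ} (hs : 1 < s) {f g : Torus → ℝ}
    (hf : MemHs s f) (hg : MemHs s g) (n : Fin 2 → ℤ)
    (hp : Summable fun m => (sobolevWeight s m * ‖fourierCoef f m‖ ^ 2)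
      * (sobolevWeight s (n - m) * ‖fourierCoef g (n - m)‖ ^ 2)) :
    sobolevWeight s n * ‖fourierCoef (fun x => f x * g x) n‖ ^ 2
      ≤ 4 ^ s * (2 * ∑' m, sobolevWeight (-s) m)
        * ∑' m, (sobolevWeight s m * ‖fourierCoef f m‖ ^ 2)
          * (sobolevWeight s (n - m) * ‖fourierCoef g (n - m)‖ ^ 2) := by
  have hw := sobolevWeight_pos s
  have hw' := sobolevWeight_pos (-s)
  have hF0 : ∀ m, 0 ≤ (sobolevWeight s m * ‖fourierCoef f m‖ ^ 2)
      * (sobolevWeight s (n - m) * ‖fourierCoef g (n - m)‖ ^ 2) := fun m =>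
    mul_nonneg (mul_nonneg (hw m).le (sq_nonneg _)) (mul_nonneg (hw _).le (sq_nonneg _))
  have hcs := summable_and_sq_tsum_le
    (x := fun m => ‖fourierCoef f m * fourierCoef g (n - m)‖)
    (fun m => norm_nonneg _) hF0 (fun m => (mul_pos (hw' m) (hw' (n - m))).le)
    (fun m => by
      have h2 := sobolevWeight_mul_neg s m
      have h3 := sobolevWeight_mul_neg s (n - m)
      rw [norm_mul]
      apply le_of_eq
      linear_combination (-(‖fourierCoef f m‖ * ‖fourierCoef g (n - m)‖) ^ 2) * h2
        - (‖fourierCoef f m‖ * ‖fourierCoef g (n - m)‖) ^ 2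
          * (sobolevWeight s m * sobolevWeight (-s) m) * h3)
    hp (sobolevWeight_mul_convolution_le hs n).1
  have h1 : ‖fourierCoef (fun x => f x * g x) n‖
      ≤ ∑' m, ‖fourierCoef f m * fourierCoef g (n - m)‖ := by
    rw [← (hasSum_fourierCoef_mul hs hf hg.1 n).tsum_eq]
    exact norm_tsum_le_tsum_norm hcs.1
  have h2 := (pow_le_pow_left₀ (norm_nonneg _) h1 2).trans hcs.2
  refine (mul_le_mul_of_nonneg_left h2 (hw n).le).trans ?_
  rw [mul_left_comm, mul_comm]
  exact mul_le_mul_of_nonneg_right (sobolevWeight_mul_convolution_le hs n).2 (tsum_nonneg hF0)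

theorem exists_mul_bound {s : ℝ} (hs : 1 < s) : ∃ C : ℝ, 0 ≤ C ∧ ∀ f g : Torus → ℝ,
    MemHs s f → MemHs s g → MemHs s (fun x => f x * g x) ∧
      hsNormSq s (fun x => f x * g x) ≤ C * (hsNormSq s f * hsNormSq s g) := by
  have hA0 : 0 ≤ ∑' n, sobolevWeight (-s) n := tsum_nonneg fun n => (sobolevWeight_pos _ n).le
  refine ⟨4 ^ s * (2 * ∑' n, sobolevWeight (-s) n), by positivity, fun f g hf hg => ?_⟩
  obtain ⟨h1, h2, h3⟩ := summable_convolution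
    (fun n => mul_nonneg (sobolevWeight_pos s n).le (sq_nonneg _))
    (fun n => mul_nonneg (sobolevWeight_pos s n).le (sq_nonneg _)) hf.2 hg.2
  have hmain := memHs_of_le (s := s) (f := fun x => f x * g x) (hf.1.mul hg.1) (h2.mul_left _)
    fun n => sobolevWeight_mul_sq_fourierCoef_mul_le hs hf hg n (h1 n)
  refine ⟨hmain.1, hmain.2.trans (le_of_eq ?_)⟩
  rw [tsum_mul_left, h3]
  rfl

theorem MemHs.mul {s : ℝ} (hs : 1 < s) {f g : Torus → ℝ} (hf : MemHs s f) (hg : MemHs s g) :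
    MemHs s fun x => f x * g x :=
  let ⟨_, _, h⟩ := exists_mul_bound hs
  (h f g hf hg).1

end VectorBGK

namespace VectorBGK

open scoped Topology

open MeasureTheory UnitAddTorus

/-! ### Differentiability on the torus -/

/-- Continuously differentiable functions on the torus. -/
structure IsC1 (g : Torus → ℝ) : Prop where
  continuous : Continuous g
  hasDerivAt : ∀ i x, HasDerivAt (fun h : ℝ => g (x + Pi.single i (h : UnitAddCircle)))
    (partialDeriv i g x) 0
  continuous_partialDeriv : ∀ i, Continuous (partialDeriv i g)

theorem isC1_of_hasDerivAt {g : Torus → ℝ} {g' : Fin 2 → Torus → ℝ} (hg : Continuous g)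
    (h : ∀ i x, HasDerivAt (fun h : ℝ => g (x + Pi.single i (h : UnitAddCircle))) (g' i x) 0)
    (hc : ∀ i, Continuous (g' i)) : IsC1 g ∧ ∀ i, partialDeriv i g = g' i := by
  have key : ∀ i, partialDeriv i g = g' i := fun i => funext fun x => (h i x).deriv
  exact ⟨⟨hg, fun i x => by rw [key]; exact h i x, fun i => by rw [key]; exact hc i⟩, key⟩

theorem IsC1.mul {f g : Torus → ℝ} (hf : IsC1 f) (hg : IsC1 g) : IsC1 fun x => f x * g x := by
  refine (isC1_of_hasDerivAt (g' := fun i x => partialDeriv i f x * g x + f x * partialDeriv i g x)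
    (hf.continuous.mul hg.continuous) (fun i x => ?_) fun i => ?_).1
  · simpa using (hf.hasDerivAt i x).fun_mul (hg.hasDerivAt i x)
  · exact ((hf.continuous_partialDeriv i).mul hg.continuous).add
      (hf.continuous.mul (hg.continuous_partialDeriv i))

theorem IsC1.const_mul {g : Torus → ℝ} (hg : IsC1 g) (c : ℝ) : IsC1 fun x => c * g x := by
  refine (isC1_of_hasDerivAt (g' := fun i x => c * partialDeriv i g x)
    (continuous_const.mul hg.continuous) (fun i x => ?_) fun i => ?_).1
  · exact (hg.hasDerivAt i x).const_mul c
  · exact continuous_const.mul (hg.continuous_partialDeriv i)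

theorem IsC1.inv {g : Torus → ℝ} (hg : IsC1 g) (h0 : ∀ x, g x ≠ 0) :
    IsC1 (fun x => (g x)⁻¹) ∧ ∀ i, partialDeriv i (fun x => (g x)⁻¹) =
      fun x => -1 * (partialDeriv i g x * ((g x)⁻¹ * (g x)⁻¹)) := by
  have hc : Continuous fun x => (g x)⁻¹ := hg.continuous.inv₀ h0
  refine isC1_of_hasDerivAt hc (fun i x => ?_) fun i => ?_
  · refine ((hg.hasDerivAt i x).fun_inv (by simpa using h0 x)).congr_deriv ?_
    simp only [AddCircle.coe_zero, Pi.single_zero, add_zero]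
    field_simp
  · exact continuous_const.mul ((hg.continuous_partialDeriv i).mul (hc.mul hc))

theorem IsC1.hasDerivAt_line {g : Torus → ℝ} (hg : IsC1 g) (i : Fin 2) (x : Torus) (t : ℝ) :
    HasDerivAt (fun h : ℝ => g (x + Pi.single i (h : UnitAddCircle)))
      (partialDeriv i g (x + Pi.single i (t : UnitAddCircle))) t := by
  have h := hg.hasDerivAt i (x + Pi.single i (t : UnitAddCircle))
  rw [← sub_self t] at h
  refine (h.comp_sub_const t t).congr_of_eventuallyEq (.of_forall fun y => ?_)
  simp only [add_assoc, ← Pi.single_add, ← AddCircle.coe_add, add_sub_cancel]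

/-! ### Translations, derivatives and Fourier coefficients. -/

theorem mFourier_add_single (n : Fin 2 → ℤ) (i : Fin 2) (x : Torus) (h : ℝ) :
    mFourier n (x + Pi.single i (h : UnitAddCircle))
      = Complex.exp (2 * Real.pi * Complex.I * n i * h) * mFourier n x := by
  have key : ∀ (k : ℤ) (y : UnitAddCircle), fourier k (y + (h : UnitAddCircle))
      = Complex.exp (2 * Real.pi * Complex.I * k * h) * fourier k y := fun k y => by
    have h1 := fourier_coe_apply (T := 1) (n := k) (x := h)
    rw [Complex.ofReal_one, div_one] at h1
    rw [← h1]
    simp only [fourier_apply, smul_add, AddCircle.toCircle_add, Circle.coe_mul]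
    ring
  fin_cases i
  · simp only [mFourier, Fin.prod_univ_two, ContinuousMap.coe_mk, Fin.zero_eta, Pi.add_apply,
      Pi.single_eq_same, key, ne_eq, one_ne_zero, not_false_eq_true, Pi.single_eq_of_ne, add_zero]
    ring
  · simp only [mFourier, Fin.prod_univ_two, ContinuousMap.coe_mk, Fin.mk_one, Pi.add_apply,
      Pi.single_eq_same, key, ne_eq, zero_ne_one, not_false_eq_true, Pi.single_eq_of_ne, add_zero]
    ring

theorem hasDerivAt_exp_line (n : Fin 2 → ℤ) (i : Fin 2) (t : ℝ) :
    HasDerivAt (fun h : ℝ => Complex.exp (2 * Real.pi * Complex.I * n i * h))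
      (2 * Real.pi * Complex.I * n i * Complex.exp (2 * Real.pi * Complex.I * n i * t)) t := by
  have h1 : HasDerivAt (fun h : ℝ => 2 * Real.pi * Complex.I * n i * (h : ℂ))
      (2 * Real.pi * Complex.I * n i) t := by
    simpa using (Complex.ofRealCLM.hasDerivAt (x := t)).const_mul (2 * Real.pi * Complex.I * n i)
  simpa [mul_comm] using h1.cexp

theorem exists_abs_le {g : Torus → ℝ} (hg : Continuous g) : ∃ B, ∀ x, |g x| ≤ B := by
  obtain ⟨B, hB⟩ := isCompact_univ.exists_bound_of_continuousOn hg.continuousOn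
  exact ⟨B, fun x => hB x trivial⟩

theorem integral_mFourier_mul_translate (g : Torus → ℝ) (i : Fin 2) (n : Fin 2 → ℤ) (h : ℝ) :
    ∫ x, mFourier (-n) x * (g (x + Pi.single i (h : UnitAddCircle)) : ℂ) ∂torusMeasure
      = Complex.exp (2 * Real.pi * Complex.I * n i * h) * fourierCoef g n := by
  have h1 := integral_add_right_eq_self (μ := torusMeasure)
    (fun x => mFourier (-n) x * (g x : ℂ)) (Pi.single i (h : UnitAddCircle))
  rw [fourierCoef_eq_integral, ← h1, ← integral_const_mul]
  congr 1; ext x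
  rw [mFourier_add_single, ← mul_assoc, ← mul_assoc, ← Complex.exp_add]
  simp

theorem hasDerivAt_integral_torus {F F' : ℝ → Torus → ℂ} {U : Set ℝ} {t B : ℝ} (hU : U ∈ 𝓝 t)
    (hF : ∀ r ∈ U, Continuous (F r)) (hF' : Continuous (F' t))
    (hB : ∀ r ∈ U, ∀ x, ‖F' r x‖ ≤ B) (hd : ∀ r ∈ U, ∀ x, HasDerivAt (F · x) (F' r x) r) :
    HasDerivAt (fun r => ∫ x, F r x ∂torusMeasure) (∫ x, F' t x ∂torusMeasure) t :=
  (hasDerivAt_integral_of_dominated_loc_of_deriv_le (bound := fun _ => B) hU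
    (Filter.mem_of_superset hU fun r hr => (integrable_torus (hF r hr)).aestronglyMeasurable)
    (integrable_torus (hF t (mem_of_mem_nhds hU))) (integrable_torus hF').aestronglyMeasurable
    (.of_forall fun x r hr => hB r hr x) (integrable_const B)
    (.of_forall fun x r hr => hd r hr x)).2

theorem hasDerivAt_fourierCoef {G G' : ℝ → Torus → ℝ} {U : Set ℝ} {t B : ℝ} (hU : U ∈ 𝓝 t)
    (hG : ∀ r ∈ U, Continuous (G r)) (hG' : Continuous (G' t))
    (hB : ∀ r ∈ U, ∀ x, |G' r x| ≤ B) (hd : ∀ r ∈ U, ∀ x, HasDerivAt (G · x) (G' r x) r)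
    (n : Fin 2 → ℤ) : HasDerivAt (fun r => fourierCoef (G r) n) (fourierCoef (G' t) n) t := by
  simp only [fourierCoef_eq_integral]
  exact hasDerivAt_integral_torus (F := fun r x => mFourier (-n) x * (G r x : ℂ))
    (F' := fun r x => mFourier (-n) x * (G' r x : ℂ)) (B := B) hU
    (fun r hr => continuous_mFourier_mul (hG r hr) _) (continuous_mFourier_mul hG' _)
    (fun r hr x => by
      rw [norm_mul, norm_mFourier_apply, one_mul, Complex.norm_real]
      exact hB r hr x)
    (fun r hr x => (hd r hr x).ofReal_comp.const_mul _)

/-- Translating g by h along axis i multiplies its n-th coefficient by exp(2πi n_i h).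
Differentiating both sides at h = 0, under the integral on the left, replaces integration by parts.
-/
theorem fourierCoef_partialDeriv {g : Torus → ℝ} (hg : IsC1 g) (i : Fin 2) (n : Fin 2 → ℤ) :
    fourierCoef (partialDeriv i g) n = 2 * Real.pi * Complex.I * n i * fourierCoef g n := by
  obtain ⟨B, hB⟩ := exists_abs_le (hg.continuous_partialDeriv i)
  have hadd : ∀ h : ℝ, Continuous fun x : Torus => x + Pi.single i (h : UnitAddCircle) :=
    fun h => continuous_id.add continuous_const
  have hd := hasDerivAt_fourierCoef (U := Set.univ) (t := 0) (B := B)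
    (G := fun h x => g (x + Pi.single i (h : UnitAddCircle)))
    (G' := fun h x => partialDeriv i g (x + Pi.single i (h : UnitAddCircle))) Filter.univ_mem
    (fun h _ => hg.continuous.comp (hadd h)) ((hg.continuous_partialDeriv i).comp (hadd 0))
    (fun h _ x => hB _) (fun h _ x => hg.hasDerivAt_line i x h) n
  simp only [fourierCoef_eq_integral (fun x => g (x + _)), integral_mFourier_mul_translate,
    AddCircle.coe_zero, Pi.single_zero, add_zero] at hd
  have hd' := ((hasDerivAt_exp_line n i 0).mul_const (fourierCoef g n)).unique hd
  rw [← hd']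
  simp

theorem norm_two_pi_mul_le (n : Fin 2 → ℤ) (i : Fin 2) :
    ‖2 * Real.pi * Complex.I * n i‖ ≤ sobolevWeight (1 / 2) n := by
  have h1 : sobolevWeight (1 / 2) n
      = √(1 + (2 * Real.pi) ^ 2 * ((n 0 : ℝ) ^ 2 + (n 1 : ℝ) ^ 2)) := by
    rw [Real.sqrt_eq_rpow]; rfl
  rw [h1]
  apply Real.le_sqrt_of_sq_le
  simp only [norm_mul, Complex.norm_I, Complex.norm_real, Complex.norm_intCast, mul_pow,
    Complex.norm_ofNat, Real.norm_eq_abs, sq_abs]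
  have : 0 ≤ (2 * Real.pi) ^ 2 := sq_nonneg _
  fin_cases i <;> simp <;> nlinarith [mul_nonneg this (sq_nonneg (n 0 : ℝ)),
    mul_nonneg this (sq_nonneg (n 1 : ℝ))]

/-- The Fourier series may be differentiated term by term: for s > 2 the coefficients multiplied by
the weight of order 1/2 are absolutely summable. -/
theorem MemHs.isC1_and_le {s : ℝ} (hs : 2 < s) {g : Torus → ℝ} (hg : MemHs s g) :
    IsC1 g ∧ ∀ i x, |partialDeriv i g x| ≤ hsNormSq s g + ∑' n, sobolevWeight (-(s - 1)) n := by
  have hsum := hg.summable_weight_mul (r := 1) (by linarith)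
  have hbound : ∀ i (n : Fin 2 → ℤ) (z w : ℂ), ‖z‖ = 1 → ‖w‖ = 1 →
      ‖fourierCoef g n * (2 * Real.pi * Complex.I * n i * z) * w‖
        ≤ sobolevWeight (1 / 2) n * ‖fourierCoef g n‖ := fun i n z w hz hw => by
    rw [norm_mul, norm_mul, norm_mul, hz, hw, mul_one, mul_one, mul_comm]
    exact mul_le_mul_of_nonneg_right (norm_two_pi_mul_le n i) (norm_nonneg _)
  have hexp : ∀ i (n : Fin 2 → ℤ) (h : ℝ),
      ‖Complex.exp (2 * Real.pi * Complex.I * n i * h)‖ = 1 := fun i n h => by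
    rw [show (2 * Real.pi * Complex.I * n i * h : ℂ) = ((2 * Real.pi * n i * h : ℝ) : ℂ) *
      Complex.I by push_cast; ring]
    exact Complex.norm_exp_ofReal_mul_I _
  -- The factor 1 is the exponential at h = 0, kept so that `hbound` applies as it stands.
  set g' : Fin 2 → Torus → ℂ := fun i x =>
    ∑' n, fourierCoef g n * (2 * Real.pi * Complex.I * n i * 1) * mFourier n x with hg'
  have hderiv : ∀ i x, HasDerivAt (fun h : ℝ => (g (x + Pi.single i (h : UnitAddCircle)) : ℂ))
      (g' i x) 0 := fun i x => by
    have h0 : ∀ h : ℝ, HasSum (fun n => fourierCoef g n *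
        Complex.exp (2 * Real.pi * Complex.I * n i * h) * mFourier n x)
        (g (x + Pi.single i (h : UnitAddCircle)) : ℂ) := fun h => by
      have := hg.hasSum_fourier (by linarith) (x + Pi.single i (h : UnitAddCircle))
      simpa only [mFourier_add_single, mul_assoc] using this
    have h1 := hasDerivAt_tsum (𝕜 := ℝ) (u := fun n => sobolevWeight (1 / 2) n * ‖fourierCoef g n‖)
      (g := fun n h => fourierCoef g n *
        Complex.exp (2 * Real.pi * Complex.I * n i * h) * mFourier n x)
      (g' := fun n h => fourierCoef g n * (2 * Real.pi * Complex.I * n i *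
        Complex.exp (2 * Real.pi * Complex.I * n i * h)) * mFourier n x) (y₀ := 0) hsum
      (fun n h => ((hasDerivAt_exp_line n i h).const_mul _).mul_const _)
      (fun n h => hbound i n _ _ (hexp i n h) (norm_mFourier_apply n x)) (h0 0).summable 0
    simp only [fun h : ℝ => (h0 h).tsum_eq] at h1
    simpa [hg'] using h1
  have hcont : ∀ i, Continuous (g' i) := fun i =>
    continuous_tsum (fun n => continuous_const.mul (mFourier n).continuous) hsum
      fun n x => hbound i n _ _ norm_one (norm_mFourier_apply n x)
  obtain ⟨h1, h2⟩ := isC1_of_hasDerivAt (g' := fun i x => (g' i x).re) hg.1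
    (fun i x => 
      Complex.reCLM.hasFDerivAt.comp_hasDerivAt (0 : ℝ) (hderiv i x))
    fun i => Complex.continuous_re.comp (hcont i)
  refine ⟨h1, fun i x => ?_⟩
  rw [h2]
  refine (Complex.abs_re_le_norm _).trans ?_
  refine le_trans ?_ (hg.tsum_weight_mul_le (r := 1) (by linarith))
  have hb := fun n => hbound i n _ _ norm_one (norm_mFourier_apply n x)
  have hs' := Summable.of_nonneg_of_le (fun n => norm_nonneg _) hb hsum
  exact (norm_tsum_le_tsum_norm hs').trans (hs'.tsum_le_tsum hb hsum)

/-! ### Sobolev norms of derivatives and reciprocals. -/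

theorem sq_norm_fourierCoef_partialDeriv {g : Torus → ℝ} (hg : IsC1 g) (i : Fin 2)
    (n : Fin 2 → ℤ) : ‖fourierCoef (partialDeriv i g) n‖ ^ 2
      = (2 * Real.pi) ^ 2 * (n i : ℝ) ^ 2 * ‖fourierCoef g n‖ ^ 2 := by
  rw [fourierCoef_partialDeriv hg]
  simp only [norm_mul, Complex.norm_I, Complex.norm_real, Complex.norm_intCast, mul_pow,
    Complex.norm_ofNat, Real.norm_eq_abs, sq_abs]
  ring

theorem sobolevWeight_succ_mul {g : Torus → ℝ} (hg : IsC1 g) (s : ℝ) (n : Fin 2 → ℤ) :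
    sobolevWeight (s + 1) n * ‖fourierCoef g n‖ ^ 2
      = sobolevWeight s n * ‖fourierCoef g n‖ ^ 2
        + (sobolevWeight s n * ‖fourierCoef (partialDeriv 0 g) n‖ ^ 2
          + sobolevWeight s n * ‖fourierCoef (partialDeriv 1 g) n‖ ^ 2) := by
  rw [sq_norm_fourierCoef_partialDeriv hg, sq_norm_fourierCoef_partialDeriv hg,
    sobolevWeight_add, sobolevWeight_one]
  ring

theorem IsC1.memHs_succ {s : ℝ} {g : Torus → ℝ} (hg : IsC1 g) (h0 : MemHs s g)
    (h : ∀ i, MemHs s (partialDeriv i g)) : MemHs (s + 1) g :=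
  (memHs_of_le hg.continuous (h0.2.add ((h 0).2.add (h 1).2))
    fun n => (sobolevWeight_succ_mul hg s n).le).1

theorem MemHs.partialDeriv {s : ℝ} (hs : 2 < s) {g : Torus → ℝ} (hg : MemHs s g) (i : Fin 2) :
    MemHs (s - 1) (partialDeriv i g) := by
  have h1 := (hg.isC1_and_le hs).1
  refine (memHs_of_le (h1.continuous_partialDeriv i) hg.2 fun n => ?_).1
  have h2 := sobolevWeight_succ_mul h1 (s - 1) n
  rw [sub_add_cancel] at h2
  rw [h2]
  have hw := (sobolevWeight_pos (s - 1) n).le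
  have h3 := mul_nonneg hw (sq_nonneg ‖fourierCoef g n‖)
  have h4 := mul_nonneg hw (sq_nonneg ‖fourierCoef (VectorBGK.partialDeriv 0 g) n‖)
  have h5 := mul_nonneg hw (sq_nonneg ‖fourierCoef (VectorBGK.partialDeriv 1 g) n‖)
  fin_cases i
  · change sobolevWeight (s - 1) n * ‖fourierCoef (VectorBGK.partialDeriv 0 g) n‖ ^ 2 ≤ _
    linarith
  · change sobolevWeight (s - 1) n * ‖fourierCoef (VectorBGK.partialDeriv 1 g) n‖ ^ 2 ≤ _
    linarith

theorem IsC1.memHs_one {g : Torus → ℝ} (hg : IsC1 g) : MemHs 1 g := by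
  simpa using hg.memHs_succ (memHs_zero_of_continuous hg.continuous)
    fun i => memHs_zero_of_continuous (hg.continuous_partialDeriv i)

/-- The Sobolev algebra is closed under inversion. -/
theorem MemHs.inv {s : ℝ} (hs : 3 < s) {g : Torus → ℝ} (hg : MemHs s g) (h0 : ∀ x, g x ≠ 0) :
    MemHs s fun x => (g x)⁻¹ := by
  have hgC := (hg.isC1_and_le (by linarith)).1
  obtain ⟨hv, hdv⟩ := hgC.inv h0
  have hd : ∀ i, MemHs (s - 1) (VectorBGK.partialDeriv i g) := hg.partialDeriv (by linarith)
  have h1 := hv.memHs_one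
  -- The derivative -∂g/g² is again C¹, because ∂g lies in H^{s-1} and s - 1 > 2. So it lies in H¹,
  -- and the reciprocal lies in H².
  have h2 : MemHs 2 fun x => (g x)⁻¹ := by
    have := hv.memHs_succ h1 fun i => by
      rw [hdv]
      exact ((((hd i).isC1_and_le (by linarith)).1.mul (hv.mul hv)).const_mul _).memHs_one
    rwa [one_add_one_eq_two] at this
  -- Bootstrap: H^{r+k} is an algebra since r + k > 1, so -∂g/g² stays in it and the reciprocal
  -- gains one order. The real offset r in (1, 2] allows s to be reached by integer steps.
  have key : ∀ (k : ℕ) (r : ℝ), 1 < r → r ≤ 2 → r + k ≤ s →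
      MemHs (r + k) fun x => (g x)⁻¹ := by
    intro k
    induction k with
    | zero => intro r _ hr _; simpa using h2.mono hr
    | succ k ih =>
      intro r hr1 hr2 hrs
      push_cast at hrs ⊢
      have hk : (0 : ℝ) ≤ k := k.cast_nonneg
      have h3 := ih r hr1 hr2 (by linarith)
      rw [← add_assoc]
      refine hv.memHs_succ h3 fun i => ?_
      rw [hdv]
      exact (((hd i).mono (by linarith)).mul (by linarith)
        (h3.mul (by linarith) h3)).const_mul _
  have hk := Nat.le_ceil (s - 2)
  have hk' := Nat.ceil_lt_add_one (by linarith : 0 ≤ s - 2)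
  have := key ⌈s - 2⌉₊ (s - ⌈s - 2⌉₊) (by linarith) (by linarith) (by linarith)
  rwa [sub_add_cancel] at this

end VectorBGK

namespace VectorBGK

open scoped Topology

open Matrix

/-! ### Linearized Maxwellians and the kinetic entropy -/

namespace Params

variable (P : Params)

/-- The coefficient `1 / (2λ)` of the fluxes in the Maxwellians. -/
noncomputable def kappa : ℝ := 1 / (2 * P.lam)

/-- The linearizations of the Maxwellians at the reference state. -/
noncomputable def linMat : Fin 5 → Matrix (Fin 3) (Fin 3) ℝ :=
  ![!![P.a, P.kappa, 0; P.kappa, P.a, 0; 0, 0, P.a],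
    !![P.a, 0, P.kappa; 0, P.a, 0; P.kappa, 0, P.a],
    !![P.a, -P.kappa, 0; -P.kappa, P.a, 0; 0, 0, P.a],
    !![P.a, 0, -P.kappa; 0, P.a, 0; -P.kappa, 0, P.a],
    !![1 - 4 * P.a, 0, 0; 0, 1 - 4 * P.a, 0; 0, 0, 1 - 4 * P.a]]

/-- The determinant of the nontrivial `2 × 2` block of a linearized Maxwellian. -/
noncomputable def blockDet : ℝ := P.a ^ 2 - P.kappa ^ 2

/-- The inverses of the linearized Maxwellians. -/
noncomputable def invMat : Fin 5 → Matrix (Fin 3) (Fin 3) ℝ :=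
  ![!![P.a / P.blockDet, -(P.kappa / P.blockDet), 0;
       -(P.kappa / P.blockDet), P.a / P.blockDet, 0; 0, 0, 1 / P.a],
    !![P.a / P.blockDet, 0, -(P.kappa / P.blockDet); 0, 1 / P.a, 0;
       -(P.kappa / P.blockDet), 0, P.a / P.blockDet],
    !![P.a / P.blockDet, P.kappa / P.blockDet, 0;
       P.kappa / P.blockDet, P.a / P.blockDet, 0; 0, 0, 1 / P.a],
    !![P.a / P.blockDet, 0, P.kappa / P.blockDet; 0, 1 / P.a, 0;
       P.kappa / P.blockDet, 0, P.a / P.blockDet],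
    !![1 / (1 - 4 * P.a), 0, 0; 0, 1 / (1 - 4 * P.a), 0; 0, 0, 1 / (1 - 4 * P.a)]]

/-- The subcharacteristic condition, under which the linearized Maxwellians are positive
definite. -/
structure Subcharacteristic : Prop where
  kappa_pos : 0 < P.kappa
  kappa_lt : P.kappa < P.a
  a_lt : P.a < 1 / 4

variable {P}

/-- Since 0 < 1 - 1/μ < 1, the lower bound on δ gives δ > 1/(2a). Combined with λ² > δ/a this yields
(2aλ)² > 2, so 1/(2λ) < a. -/
theorem subcharacteristic (hP : P.Pos) (hd : P.Dissipation) (hl : P.LargeVelocity) :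
    P.Subcharacteristic := by
  obtain ⟨⟨μ, δ, hμ, -, hδ, hlam⟩, -⟩ := hl
  have ha := hd.1
  have hl0 := hP.1
  refine ⟨by unfold kappa; positivity, ?_, hd.2⟩
  have h1 : 1 / (2 * P.a * (1 - 1 / μ)) < δ := lt_of_le_of_lt (le_max_right _ _) hδ
  have h2 : √(δ / P.a) < P.lam := lt_of_le_of_lt (le_max_left _ _) hlam
  have h3 : 0 < 1 - 1 / μ := by
    rw [sub_pos, div_lt_one (by linarith)]; exact hμ
  have h4 : 1 - 1 / μ < 1 := by
    have : 0 < 1 / μ := by positivity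
    linarith
  have h5 : 1 / (2 * P.a) < δ := by
    refine lt_trans ?_ h1
    apply one_div_lt_one_div_of_lt (by positivity)
    nlinarith
  have h6 : δ / P.a < P.lam ^ 2 := (Real.sqrt_lt' hl0).1 h2
  rw [div_lt_iff₀ (by positivity)] at h5
  rw [div_lt_iff₀ ha] at h6
  unfold kappa
  rw [div_lt_iff₀ (by positivity)]
  by_contra hcon
  push Not at hcon
  have h7 : P.a * (2 * P.lam) * (P.a * (2 * P.lam)) ≤ 1 :=
    mul_le_one₀ hcon (by positivity) hcon
  nlinarith

theorem Subcharacteristic.a_pos (h : P.Subcharacteristic) : 0 < P.a :=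
  h.kappa_pos.trans h.kappa_lt

theorem Subcharacteristic.blockDet_pos (h : P.Subcharacteristic) : 0 < P.blockDet := by
  unfold blockDet
  nlinarith [h.kappa_pos, h.kappa_lt]

theorem Subcharacteristic.linMat_mul_invMat (h : P.Subcharacteristic) (l : Fin 5) :
    P.linMat l * P.invMat l = 1 := by
  have hD := h.blockDet_pos.ne'
  have ha := h.a_pos.ne'
  have h4 : 1 - 4 * P.a ≠ 0 := by linarith [h.a_lt]
  have hD' : P.blockDet = P.a ^ 2 - P.kappa ^ 2 := rfl
  ext j k
  fin_cases l <;> fin_cases j <;> fin_cases k <;>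
    simp [linMat, invMat, Matrix.mul_apply, Fin.sum_univ_three, ha, h4] <;>
    (field_simp; rw [hD']; ring)

theorem Subcharacteristic.invMat_mul_linMat (h : P.Subcharacteristic) (l : Fin 5) :
    P.invMat l * P.linMat l = 1 := mul_eq_one_comm.1 (h.linMat_mul_invMat l)

theorem sum_linMat : ∑ l, P.linMat l = 1 := by
  ext j k
  fin_cases j <;> fin_cases k <;> simp [linMat, Fin.sum_univ_five, Matrix.add_apply] <;> ring

theorem invMat_transpose (l : Fin 5) : (P.invMat l)ᵀ = P.invMat l := by
  ext j k
  fin_cases l <;> fin_cases j <;> fin_cases k <;> simp [invMat, Matrix.transpose_apply]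

/-- An upper bound for the eigenvalues of the matrices `invMat`. -/
noncomputable def invBound (P : Params) : ℝ := 1 / (P.a - P.kappa) + 1 / (1 - 4 * P.a)

/-- The inverse block has eigenvalues 1/(a + κ) and 1/(a - κ), and a + κ < 1. -/
theorem Subcharacteristic.one_le_block (h : P.Subcharacteristic) (x y : ℝ) :
    x ^ 2 + y ^ 2 ≤ P.a / P.blockDet * (x ^ 2 + y ^ 2) - 2 * (P.kappa / P.blockDet) * (x * y) ∧
    P.a / P.blockDet * (x ^ 2 + y ^ 2) - 2 * (P.kappa / P.blockDet) * (x * y)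
      ≤ 1 / (P.a - P.kappa) * (x ^ 2 + y ^ 2) := by
  have hD := h.blockDet_pos
  have hk := h.kappa_pos
  have hka := h.kappa_lt
  have ha := h.a_lt
  have h1 : 1 / (P.a - P.kappa) = (P.a + P.kappa) / P.blockDet := by
    rw [div_eq_div_iff (by linarith) hD.ne']
    unfold blockDet; ring
  have h2 : P.a / P.blockDet * (x ^ 2 + y ^ 2) - 2 * (P.kappa / P.blockDet) * (x * y)
      = (P.a * (x ^ 2 + y ^ 2) - 2 * P.kappa * (x * y)) / P.blockDet := by ring
  rw [h1, h2, le_div_iff₀ hD, div_mul_eq_mul_div]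
  constructor
  · have h3 : P.blockDet ≤ P.a - P.kappa := by
      unfold blockDet
      nlinarith
    nlinarith [mul_le_mul_of_nonneg_left h3 (by positivity : 0 ≤ x ^ 2 + y ^ 2),
      mul_nonneg hk.le (sq_nonneg (x - y))]
  · apply div_le_div_of_nonneg_right _ hD.le
    nlinarith [mul_nonneg hk.le (sq_nonneg (x + y))]

/-- The eigenvalues of `linMat l` are a ± κ and a, or 1 - 4a; all lie in (0, 1), so the inverse
dominates the identity. Adding the two possible largest reciprocals gives one bound for every l. -/
theorem Subcharacteristic.invMat_bounds (h : P.Subcharacteristic) (l : Fin 5) (v : Fin 3 → ℝ) :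
    ∑ j, v j ^ 2 ≤ v ⬝ᵥ P.invMat l *ᵥ v ∧ v ⬝ᵥ P.invMat l *ᵥ v ≤ P.invBound * ∑ j, v j ^ 2 := by
  have hk := h.kappa_pos
  have hka := h.kappa_lt
  have ha := h.a_lt
  have ha0 := h.a_pos
  have b1 : 1 ≤ 1 / P.a := by rw [le_div_iff₀ ha0]; linarith
  have b2 : 1 / P.a ≤ 1 / (P.a - P.kappa) := one_div_le_one_div_of_le (by linarith) (by linarith)
  have b3 : 1 ≤ 1 / (1 - 4 * P.a) := by rw [le_div_iff₀ (by linarith)]; linarith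
  have b4 : 0 ≤ 1 / (P.a - P.kappa) := by linarith
  have b5 : P.invBound = 1 / (P.a - P.kappa) + 1 / (1 - 4 * P.a) := rfl
  rw [b5]
  have q := fun j => sq_nonneg (v j)
  have e1 := fun j => mul_le_mul_of_nonneg_right b1 (q j)
  have e2 := fun j => mul_le_mul_of_nonneg_right b2 (q j)
  have e3 := fun j => mul_le_mul_of_nonneg_right b3 (q j)
  have e4 := fun j => mul_nonneg b4 (q j)
  have i01 := h.one_le_block (v 0) (v 1)
  have i02 := h.one_le_block (v 0) (v 2)
  have i01' := h.one_le_block (v 0) (-v 1)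
  have i02' := h.one_le_block (v 0) (-v 2)
  have := e1 1; have := e1 2; have := e2 1; have := e2 2
  have := e3 0; have := e3 1; have := e3 2
  have := e4 0; have := e4 1; have := e4 2
  have := q 0; have := q 1; have := q 2
  fin_cases l <;>
    simp only [invMat, Matrix.mulVec, dotProduct, Fin.sum_univ_three, Matrix.of_apply,
      Matrix.cons_val', Matrix.cons_val_zero, Matrix.cons_val_one, Matrix.cons_val,
      Fin.zero_eta, Fin.mk_one, Fin.reduceFinMk] <;>
    constructor <;> linarith

/-! ### Kinetic entropy -/

/-- The symmetric bilinear form of the kinetic entropy. -/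
noncomputable def entropyForm (P : Params) (X Z : Fin 5 → Fin 3 → ℝ) : ℝ :=
  ∑ l, X l ⬝ᵥ P.invMat l *ᵥ Z l

theorem entropyForm_comm (X Z : Fin 5 → Fin 3 → ℝ) :
    P.entropyForm X Z = P.entropyForm Z X := by
  refine Finset.sum_congr rfl fun l _ => ?_
  rw [Matrix.dotProduct_mulVec, ← Matrix.mulVec_transpose, invMat_transpose, dotProduct_comm]

theorem Subcharacteristic.entropyForm_bounds (h : P.Subcharacteristic)
    (X : Fin 5 → Fin 3 → ℝ) : ∑ l, ∑ j, X l j ^ 2 ≤ P.entropyForm X X ∧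
      P.entropyForm X X ≤ P.invBound * ∑ l, ∑ j, X l j ^ 2 := by
  refine ⟨Finset.sum_le_sum fun l _ => (h.invMat_bounds l (X l)).1, ?_⟩
  rw [Finset.mul_sum]
  exact Finset.sum_le_sum fun l _ => (h.invMat_bounds l (X l)).2

theorem Subcharacteristic.invBound_nonneg (h : P.Subcharacteristic) : 0 ≤ P.invBound := by
  have := h.kappa_lt
  have := h.a_lt
  exact add_nonneg (one_div_nonneg.2 (by linarith)) (one_div_nonneg.2 (by linarith))

/-- The entropy production of the relaxation term. -/
theorem Subcharacteristic.entropy_production_le (h : P.Subcharacteristic)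
    (X N : Fin 5 → Fin 3 → ℝ) (hN : ∑ l, N l = 0) :
    P.entropyForm X (fun l => P.linMat l *ᵥ (∑ m, X m) + N l - X l)
      ≤ 1 / 4 * P.entropyForm N N := by
  set w := ∑ m, X m with hw
  -- Relaxation conserves the moment, because the `linMat l` add up to the identity and N has zero
  -- sum.
  have hsum : ∑ l, (P.linMat l *ᵥ w + N l - X l) = 0 := by
    rw [Finset.sum_sub_distrib, Finset.sum_add_distrib, hN, ← Matrix.sum_mulVec, sum_linMat,
      Matrix.one_mulVec, ← hw]
    simp
  -- Tested against the equilibrium part, `invMat l` cancels `linMat l`, and w is paired with the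
  -- total relaxation term, which is zero.
  have hlin : ∑ l, (P.linMat l *ᵥ w) ⬝ᵥ P.invMat l *ᵥ (P.linMat l *ᵥ w + N l - X l) = 0 := by
    have h1 : ∀ l, (P.linMat l *ᵥ w) ⬝ᵥ P.invMat l *ᵥ (P.linMat l *ᵥ w + N l - X l)
        = w ⬝ᵥ (P.linMat l *ᵥ w + N l - X l) := fun l => by
      rw [Matrix.dotProduct_mulVec, ← Matrix.mulVec_transpose, invMat_transpose,
        Matrix.mulVec_mulVec, h.invMat_mul_linMat, Matrix.one_mulVec]
    simp only [h1]
    rw [← dotProduct_sum, hsum, dotProduct_zero]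
  -- For z = X l - y, complete the square: ⟨z, N - z⟩ ≤ ⟨N, N⟩/4 in the metric of `invMat l`.
  have hquad : ∀ l, X l ⬝ᵥ P.invMat l *ᵥ (P.linMat l *ᵥ w + N l - X l)
      - (P.linMat l *ᵥ w) ⬝ᵥ P.invMat l *ᵥ (P.linMat l *ᵥ w + N l - X l)
      ≤ 1 / 4 * (N l ⬝ᵥ P.invMat l *ᵥ N l) := fun l => by
    set y := P.linMat l *ᵥ w
    have h0 : 0 ≤ (X l - y - (1 / 2 : ℝ) • N l) ⬝ᵥ P.invMat l *ᵥ (X l - y - (1 / 2 : ℝ) • N l) :=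
      le_trans (Finset.sum_nonneg fun _ _ => sq_nonneg _) (h.invMat_bounds l _).1
    have hc : ∀ u v : Fin 3 → ℝ, u ⬝ᵥ P.invMat l *ᵥ v = v ⬝ᵥ P.invMat l *ᵥ u := fun u v => by
      rw [Matrix.dotProduct_mulVec, ← Matrix.mulVec_transpose, invMat_transpose, dotProduct_comm]
    simp only [Matrix.mulVec_add, Matrix.mulVec_sub, Matrix.mulVec_smul, dotProduct_add,
      dotProduct_sub, sub_dotProduct, smul_dotProduct, dotProduct_smul, smul_eq_mul] at h0 ⊢
    have c1 := hc (X l) y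
    have c2 := hc (X l) (N l)
    have c3 := hc y (N l)
    linarith
  have := Finset.sum_le_sum fun l (_ : l ∈ Finset.univ) => hquad l
  rw [Finset.sum_sub_distrib, hlin, sub_zero, ← Finset.mul_sum] at this
  exact this

theorem hasDerivAt_entropyForm {X : ℝ → Fin 5 → Fin 3 → ℝ} {X' : Fin 5 → Fin 3 → ℝ} {t : ℝ}
    (hX : ∀ l j, HasDerivAt (fun r => X r l j) (X' l j) t) :
    HasDerivAt (fun r => P.entropyForm (X r) (X r)) (2 * P.entropyForm (X t) X') t := by
  have h1 : HasDerivAt (fun r => P.entropyForm (X r) (X r))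
      (P.entropyForm X' (X t) + P.entropyForm (X t) X') t := by
    unfold entropyForm
    simp only [dotProduct, Matrix.mulVec]
    rw [← Finset.sum_add_distrib]
    refine HasDerivAt.fun_sum fun l _ => ?_
    rw [← Finset.sum_add_distrib]
    refine HasDerivAt.fun_sum fun j _ => ?_
    exact (hX l j).fun_mul (HasDerivAt.fun_sum fun k _ => (hX l k).const_mul _)
  refine h1.congr_deriv ?_
  rw [entropyForm_comm X']
  ring

theorem entropyForm_smul_right (c : ℝ) (X Z : Fin 5 → Fin 3 → ℝ) :
    P.entropyForm X (fun l => c • Z l) = c * P.entropyForm X Z := by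
  simp only [entropyForm, Matrix.mulVec_smul, dotProduct_smul, smul_eq_mul, Finset.mul_sum]

theorem entropyForm_add_right (X Y Z : Fin 5 → Fin 3 → ℝ) :
    P.entropyForm X (fun l => Y l + Z l) = P.entropyForm X Y + P.entropyForm X Z := by
  simp only [entropyForm, Matrix.mulVec_add, dotProduct_add, Finset.sum_add_distrib]

/-- The transport symbol is a scalar θ_l on each population, so it commutes with `invMat l`. This
symmetry makes the transport terms of the real and imaginary parts of a mode cancel. -/
theorem entropyForm_weight (θ : Fin 5 → ℝ) (X Z : Fin 5 → Fin 3 → ℝ) :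
    P.entropyForm X (fun l => θ l • Z l) = P.entropyForm Z (fun l => θ l • X l) := by
  refine Finset.sum_congr rfl fun l _ => ?_
  rw [Matrix.mulVec_smul, Matrix.mulVec_smul, dotProduct_smul, dotProduct_smul,
    Matrix.dotProduct_mulVec, ← Matrix.mulVec_transpose, invMat_transpose, dotProduct_comm]

/-- Entropy decay of one Fourier mode `X + iY` of the linearized system with source `N + iR`. -/
theorem Subcharacteristic.hasDerivAt_entropy_mode (h : P.Subcharacteristic)
    {X Y : ℝ → Fin 5 → Fin 3 → ℝ} {N R : Fin 5 → Fin 3 → ℝ} {θ : Fin 5 → ℝ} {κ t : ℝ}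
    (hκ : 0 ≤ κ) (hN : ∑ l, N l = 0) (hR : ∑ l, R l = 0)
    (hX : ∀ l j, HasDerivAt (fun r => X r l j)
      (κ * (P.linMat l *ᵥ (∑ m, X t m) + N l - X t l) j + θ l * Y t l j) t)
    (hY : ∀ l j, HasDerivAt (fun r => Y r l j)
      (κ * (P.linMat l *ᵥ (∑ m, Y t m) + R l - Y t l) j - θ l * X t l j) t) :
    ∃ d, HasDerivAt (fun r => P.entropyForm (X r) (X r) + P.entropyForm (Y r) (Y r)) d t ∧
      d ≤ κ / 2 * P.invBound * (∑ l, ∑ j, N l j ^ 2 + ∑ l, ∑ j, R l j ^ 2) := by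
  refine ⟨_, (hasDerivAt_entropyForm hX).add (hasDerivAt_entropyForm hY), ?_⟩
  have e1 : P.entropyForm (X t) (fun l j =>
      κ * (P.linMat l *ᵥ (∑ m, X t m) + N l - X t l) j + θ l * Y t l j)
      = κ * P.entropyForm (X t) (fun l => P.linMat l *ᵥ (∑ m, X t m) + N l - X t l)
        + P.entropyForm (X t) (fun l => θ l • Y t l) := by
    rw [← entropyForm_smul_right, ← entropyForm_add_right]
    rfl
  have e2 : P.entropyForm (Y t) (fun l j =>
      κ * (P.linMat l *ᵥ (∑ m, Y t m) + R l - Y t l) j - θ l * X t l j)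
      = κ * P.entropyForm (Y t) (fun l => P.linMat l *ᵥ (∑ m, Y t m) + R l - Y t l)
        - P.entropyForm (X t) (fun l => θ l • Y t l) := by
    rw [← entropyForm_smul_right κ, entropyForm_weight θ (X t) (Y t), sub_eq_add_neg,
      ← neg_one_mul, ← entropyForm_smul_right (-1), ← entropyForm_add_right]
    congr 1
    ext l j
    simp [sub_eq_add_neg]
    ring
  rw [e1, e2]
  have p1 := mul_le_mul_of_nonneg_left (h.entropy_production_le (X t) N hN) hκ
  have p2 := mul_le_mul_of_nonneg_left (h.entropy_production_le (Y t) R hR) hκ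
  have p3 := mul_le_mul_of_nonneg_left (h.entropyForm_bounds N).2 hκ
  have p4 := mul_le_mul_of_nonneg_left (h.entropyForm_bounds R).2 hκ
  linarith

end Params

end VectorBGK

namespace VectorBGK

open scoped Topology

open Matrix

/-! ### The symmetrizer -/

section Symmetrizer

variable {P : Params}

/-- The conservative state as a linear function of the fluctuations of the kinetic unknowns. -/
noncomputable def fluctState (P : Params) (ε : ℝ) (G : Fin 5 → Fin 3 → ℝ) : Fin 5 × Fin 3 → ℝ :=
  fun p => (![∑ l, G l,
     ε ^ 2 • (P.lam / ε) • (G 0 - G 2),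
     ε ^ 2 • (P.lam / ε) • (G 1 - G 3),
     ε ^ 2 • (G 0 + G 2),
     ε ^ 2 • (G 1 + G 3)] : Fin 5 → Fin 3 → ℝ) p.1 p.2

/-- The fluctuations of the kinetic unknowns around the reference equilibrium. -/
noncomputable def fluct (P : Params) (F : Fin 5 → Fin 3 → ℝ) : Fin 5 → Fin 3 → ℝ :=
  fun l => F l - ![P.a, P.a, P.a, P.a, 1 - 4 * P.a] l • P.wBar

theorem sum_fluct (F : Fin 5 → Fin 3 → ℝ) : ∑ l, fluct P F l = moment F - P.wBar := by
  simp only [fluct, Finset.sum_sub_distrib, ← Finset.sum_smul, moment]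
  congr 1
  simp only [Fin.sum_univ_five]
  ext j
  simp
  ring

theorem state_eq_fluctState (ε : ℝ) (F : Fin 5 → Fin 3 → ℝ) :
    state P ε F = fluctState P ε (fluct P F) := by
  ext ⟨i, j⟩
  unfold fluctState
  rw [sum_fluct]
  fin_cases i <;> simp [state, fluct] <;> ring

theorem fluctState_surjective {ε : ℝ} (hε : ε ≠ 0) (hl : P.lam ≠ 0) (W : Fin 5 × Fin 3 → ℝ) :
    ∃ G, fluctState P ε G = W := by
  refine ⟨fun l j => ![(W (3, j) / ε ^ 2 + W (1, j) / (ε * P.lam)) / 2,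
    (W (4, j) / ε ^ 2 + W (2, j) / (ε * P.lam)) / 2,
    (W (3, j) / ε ^ 2 - W (1, j) / (ε * P.lam)) / 2,
    (W (4, j) / ε ^ 2 - W (2, j) / (ε * P.lam)) / 2,
    W (0, j) - W (3, j) / ε ^ 2 - W (4, j) / ε ^ 2] l, ?_⟩
  ext ⟨i, j⟩
  fin_cases i <;> simp [fluctState, Fin.sum_univ_five] <;> field_simp <;> ring

/-- The preimage of `fluctState` under the symmetrizer, in terms of `y l = (invMat l) (G l)`. -/
noncomputable def dualState (P : Params) (ε : ℝ) (y : Fin 5 → Fin 3 → ℝ) : Fin 5 × Fin 3 → ℝ :=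
  fun p => ![y 4 p.2,
    (y 0 p.2 - y 2 p.2) / (2 * P.lam) / ε,
    (y 1 p.2 - y 3 p.2) / (2 * P.lam) / ε,
    ((y 0 p.2 + y 2 p.2) / 2 - y 4 p.2) / ε ^ 2,
    ((y 1 p.2 + y 3 p.2) / 2 - y 4 p.2) / ε ^ 2] p.1

theorem symmetrizer_mulVec (ε : ℝ) (x : Fin 5 × Fin 3 → ℝ) (i : Fin 5) (j : Fin 3) :
    (symmetrizer P ε *ᵥ x) (i, j)
      = ∑ q, (symmetrizerBlocks P ε i q *ᵥ fun k => x (q, k)) j := by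
  rw [Matrix.mulVec, dotProduct, Fintype.sum_prod_type]
  rfl

theorem sigma1_mulVec (v : Fin 3 → ℝ) : sigma1 *ᵥ v = ![v 1, v 0, 0] := by
  ext j
  fin_cases j <;> simp [sigma1, Matrix.mulVec, dotProduct, Fin.sum_univ_three]

theorem sigma2_mulVec (v : Fin 3 → ℝ) : sigma2 *ᵥ v = ![v 2, 0, v 0] := by
  ext j
  fin_cases j <;> simp [sigma2, Matrix.mulVec, dotProduct, Fin.sum_univ_three]

theorem linMat_mulVec (l : Fin 5) (v : Fin 3 → ℝ) : P.linMat l *ᵥ v =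
    (![P.a • v + P.kappa • ![v 1, v 0, 0], P.a • v + P.kappa • ![v 2, 0, v 0],
      P.a • v - P.kappa • ![v 1, v 0, 0], P.a • v - P.kappa • ![v 2, 0, v 0],
      (1 - 4 * P.a) • v] : Fin 5 → Fin 3 → ℝ) l := by
  ext j
  fin_cases l <;> fin_cases j <;>
    simp [Params.linMat, Matrix.mulVec, dotProduct, Fin.sum_univ_three, Matrix.vecHead,
      Matrix.vecTail] <;> ring

/-- With S the matrix of `fluctState`, the map `dualState` is the inverse of Sᵀ; the identity says Σ
= S diag(`linMat l`) Sᵀ. It links the symmetrizer to the kinetic entropy. -/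
theorem symmetrizer_mulVec_dualState {ε : ℝ} (hε : ε ≠ 0) (hl : P.lam ≠ 0)
    (y : Fin 5 → Fin 3 → ℝ) :
    symmetrizer P ε *ᵥ dualState P ε y = fluctState P ε fun l => P.linMat l *ᵥ y l := by
  have hk : P.kappa = 1 / (2 * P.lam) := rfl
  ext ⟨i, j⟩
  rw [symmetrizer_mulVec]
  simp only [fluctState, linMat_mulVec, Fin.sum_univ_five, hk]
  fin_cases i <;>
    simp only [symmetrizerBlocks, dualState, Matrix.of_apply, Matrix.cons_val', Matrix.cons_val,
      Matrix.smul_mulVec, Matrix.one_mulVec, Matrix.zero_mulVec, sigma1_mulVec, sigma2_mulVec,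
      Fin.zero_eta, Fin.mk_one, Fin.reduceFinMk, Pi.add_apply, Pi.sub_apply, Pi.smul_apply,
      smul_eq_mul, Pi.zero_apply] <;>
    fin_cases j <;> simp <;> field_simp <;> ring

theorem symState_eq {ε : ℝ} (hε : ε ≠ 0) (hl : P.lam ≠ 0) (h : P.Subcharacteristic)
    (F : Fin 5 → Fin 3 → ℝ) :
    symmetrizer P ε *ᵥ symState P ε F = state P ε F ∧
      symState P ε F = dualState P ε fun l => P.invMat l *ᵥ fluct P F l := by
  have hlin : ∀ G : Fin 5 → Fin 3 → ℝ,
      symmetrizer P ε *ᵥ dualState P ε (fun l => P.invMat l *ᵥ G l) = fluctState P ε G := by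
    intro G
    rw [symmetrizer_mulVec_dualState hε hl]
    simp only [Matrix.mulVec_mulVec, h.linMat_mul_invMat, Matrix.one_mulVec]
  -- By `hlin` the range of Σ contains that of `fluctState`, which is everything; a surjective
  -- square matrix is invertible, so no determinant has to be computed.
  have hunit : IsUnit (symmetrizer P ε) := by
    rw [← Matrix.mulVec_surjective_iff_isUnit]
    intro W
    obtain ⟨G, hG⟩ := fluctState_surjective hε hl W
    exact ⟨_, (hlin G).trans hG⟩
  have hdet := (Matrix.isUnit_iff_isUnit_det _).1 hunit
  refine ⟨?_, ?_⟩
  · rw [symState, Matrix.mulVec_mulVec, Matrix.mul_nonsing_inv _ hdet, Matrix.one_mulVec]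
  · rw [symState, state_eq_fluctState, ← hlin, Matrix.mulVec_mulVec,
      Matrix.nonsing_inv_mul _ hdet, Matrix.one_mulVec]

end Symmetrizer

end VectorBGK

namespace VectorBGK

open scoped Topology

open Set Matrix

/-! ### Energy estimate for kinetic systems with a source -/

theorem fourierCoef_sum {ι : Type*} (t : Finset ι) {f : ι → Torus → ℝ}
    (hf : ∀ i, Continuous (f i)) (n : Fin 2 → ℤ) :
    fourierCoef (fun x => ∑ i ∈ t, f i x) n = ∑ i ∈ t, fourierCoef (f i) n := by
  classical
  induction t using Finset.induction_on with
  | empty => simp [fourierCoef_const]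
  | insert i t hi ih =>
    simp only [Finset.sum_insert hi]
    rw [fourierCoef_add (hf i) (continuous_finsetSum _ fun j _ => hf j), ih]

/-- The sum of the squares of the `H^s` norms of the components of a kinetic unknown. -/
noncomputable def kineticNormSq (s : ℝ) (G : Torus → Fin 5 → Fin 3 → ℝ) : ℝ :=
  ∑ l, ∑ j, hsNormSq s fun x => G x l j

theorem kineticNormSq_nonneg (s : ℝ) (G : Torus → Fin 5 → Fin 3 → ℝ) : 0 ≤ kineticNormSq s G :=
  Finset.sum_nonneg fun _ _ => Finset.sum_nonneg fun _ _ => hsNormSq_nonneg _ _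

theorem hsNormSq_le_kinetic (s : ℝ) (G : Torus → Fin 5 → Fin 3 → ℝ) (l : Fin 5) (j : Fin 3) :
    hsNormSq s (fun x => G x l j) ≤ kineticNormSq s G :=
  (Finset.single_le_sum (f := fun j => hsNormSq s fun x => G x l j)
    (fun _ _ => hsNormSq_nonneg _ _) (Finset.mem_univ j)).trans
  (Finset.single_le_sum (f := fun l => ∑ j, hsNormSq s fun x => G x l j)
    (fun _ _ => Finset.sum_nonneg fun _ _ => hsNormSq_nonneg _ _) (Finset.mem_univ l))

theorem kineticNormSq_le {s B : ℝ} {G : Torus → Fin 5 → Fin 3 → ℝ}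
    (h : ∀ l j, hsNormSq s (fun x => G x l j) ≤ B) : kineticNormSq s G ≤ 15 * B := by
  refine (Finset.sum_le_sum fun l _ => Finset.sum_le_sum fun j _ => h l j).trans (le_of_eq ?_)
  simp
  ring

theorem hasSum_kineticNormSq {s : ℝ} {G : Torus → Fin 5 → Fin 3 → ℝ}
    (hG : ∀ l j, MemHs s fun x => G x l j) :
    HasSum (fun n => sobolevWeight s n * ∑ l, ∑ j, ‖fourierCoef (fun x => G x l j) n‖ ^ 2)
      (kineticNormSq s G) := by
  simp only [Finset.mul_sum]
  exact hasSum_sum fun l _ => hasSum_sum fun j _ => (hG l j).2.hasSum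

/-- The linear kinetic system with source `N` on the time interval `[0, b]`, together with the
regularity used in the energy estimate. -/
structure IsKineticFlow (P : Params) (ε s b : ℝ) (G N : ℝ → Torus → Fin 5 → Fin 3 → ℝ) :
    Prop where
  memHs : ∀ r ∈ Icc 0 b, ∀ l j, MemHs s fun x => G r x l j
  memHs_source : ∀ r ∈ Icc 0 b, ∀ l j, MemHs s fun x => N r x l j
  bounded : ∃ B, ∀ r ∈ Icc 0 b, ∀ l j, hsNormSq s (fun x => G r x l j) ≤ B
  bounded_source : ∃ B, ∀ r ∈ Icc 0 b, ∀ l j, hsNormSq s (fun x => N r x l j) ≤ B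
  sum_source : ∀ r ∈ Icc 0 b, ∀ x, ∑ l, N r x l = 0
  continuousOn_mode : ∀ l j n, ContinuousOn (fun r => fourierCoef (fun x => G r x l j) n) (Icc 0 b)
  equation : ∀ r ∈ Ioo 0 b, ∀ x l j, HasDerivAt (fun r => G r x l j)
    (1 / (P.tau * ε ^ 2) * (P.linMat l *ᵥ (∑ m, G r x m) + N r x l - G r x l) j
      - ∑ i, velocity P ε l i * partialDeriv i (fun y => G r y l j) x) r

namespace IsKineticFlow

variable {P : Params} {ε s b : ℝ} {G N : ℝ → Torus → Fin 5 → Fin 3 → ℝ}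

/-- Supplies the dominating constant for differentiating Fourier coefficients in time. The condition
s > 2 bounds the space derivatives. -/
theorem exists_rhs_bound (h : IsKineticFlow P ε s b G N) (hs : 2 < s) (l : Fin 5) (j : Fin 3) :
    ∃ B, ∀ r ∈ Icc 0 b, ∀ x,
      |1 / (P.tau * ε ^ 2) * (P.linMat l *ᵥ (∑ m, G r x m) + N r x l - G r x l) j
        - ∑ i, velocity P ε l i * partialDeriv i (fun y => G r y l j) x| ≤ B := by
  obtain ⟨B₁, hB₁⟩ := h.bounded
  obtain ⟨B₂, hB₂⟩ := h.bounded_source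
  set c₁ := ∑' n, sobolevWeight (-s) n
  set c₂ := ∑' n, sobolevWeight (-(s - 1)) n
  refine ⟨|1 / (P.tau * ε ^ 2)| * ((∑ k, |P.linMat l j k| * ∑ _m : Fin 5, (B₁ + c₁))
    + (B₂ + c₁) + (B₁ + c₁)) + ∑ i, |velocity P ε l i| * (B₁ + c₂), fun r hr x => ?_⟩
  have hG : ∀ m k, |G r x m k| ≤ B₁ + c₁ := fun m k =>
    ((h.memHs r hr m k).abs_le (by linarith) x).trans (by linarith [hB₁ r hr m k])
  have hN : |N r x l j| ≤ B₂ + c₁ :=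
    ((h.memHs_source r hr l j).abs_le (by linarith) x).trans (by linarith [hB₂ r hr l j])
  have hD : ∀ i, |partialDeriv i (fun y => G r y l j) x| ≤ B₁ + c₂ := fun i =>
    (((h.memHs r hr l j).isC1_and_le hs).2 i x).trans (by linarith [hB₁ r hr l j])
  refine (abs_sub _ _).trans (add_le_add ?_ ?_)
  · rw [abs_mul]
    refine mul_le_mul_of_nonneg_left ?_ (abs_nonneg _)
    simp only [Pi.sub_apply, Pi.add_apply]
    refine (abs_sub _ _).trans (add_le_add ((abs_add_le _ _).trans (add_le_add ?_ hN)) (hG l j))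
    rw [Matrix.mulVec, dotProduct]
    refine (Finset.abs_sum_le_sum_abs _ _).trans (Finset.sum_le_sum fun k _ => ?_)
    rw [abs_mul, Finset.sum_apply]
    exact mul_le_mul_of_nonneg_left ((Finset.abs_sum_le_sum_abs _ _).trans
      (Finset.sum_le_sum fun m _ => hG m k)) (abs_nonneg _)
  · refine (Finset.abs_sum_le_sum_abs _ _).trans (Finset.sum_le_sum fun i _ => ?_)
    rw [abs_mul]
    exact mul_le_mul_of_nonneg_left (hD i) (abs_nonneg _)

/-- With constant coefficients each Fourier mode obeys its own forced ODE, in which transport is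
multiplication by a purely imaginary number. -/
theorem hasDerivAt_mode (h : IsKineticFlow P ε s b G N) (hs : 2 < s) {t : ℝ} (ht : t ∈ Ioo 0 b)
    (l : Fin 5) (j : Fin 3) (n : Fin 2 → ℤ) :
    HasDerivAt (fun r => fourierCoef (fun x => G r x l j) n)
      (((1 / (P.tau * ε ^ 2) : ℝ) : ℂ) *
          (∑ k, P.linMat l j k * ∑ m, fourierCoef (fun x => G t x m k) n
            + fourierCoef (fun x => N t x l j) n - fourierCoef (fun x => G t x l j) n)
        - ((∑ i, velocity P ε l i * (2 * Real.pi * n i) : ℝ) : ℂ) * Complex.I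
          * fourierCoef (fun x => G t x l j) n) t := by
  have hIoo : Ioo 0 b ⊆ Icc 0 b := Ioo_subset_Icc_self
  have htI := hIoo ht
  obtain ⟨B, hB⟩ := h.exists_rhs_bound hs l j
  have hC1 := ((h.memHs t htI l j).isC1_and_le hs).1
  have hGc : ∀ m k, Continuous fun x => G t x m k := fun m k => (h.memHs t htI m k).1
  have hNc : Continuous fun x => N t x l j := (h.memHs_source t htI l j).1
  have hwc : Continuous fun x => ∑ k, P.linMat l j k * ∑ m, G t x m k :=
    continuous_finsetSum _ fun k _ => continuous_const.mul
      (continuous_finsetSum _ fun m _ => hGc m k)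
  have hvc : Continuous fun x =>
      ∑ i, velocity P ε l i * partialDeriv i (fun y => G t y l j) x :=
    continuous_finsetSum _ fun i _ => continuous_const.mul (hC1.continuous_partialDeriv i)
  have heq : ∀ r x, 1 / (P.tau * ε ^ 2) * (P.linMat l *ᵥ (∑ m, G r x m) + N r x l - G r x l) j
      - ∑ i, velocity P ε l i * partialDeriv i (fun y => G r y l j) x
      = 1 / (P.tau * ε ^ 2) * (∑ k, P.linMat l j k * ∑ m, G r x m k + N r x l j - G r x l j)
      - ∑ i, velocity P ε l i * partialDeriv i (fun y => G r y l j) x := fun r x => by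
    simp [Matrix.mulVec, dotProduct, Finset.sum_apply]
  have hd := hasDerivAt_fourierCoef (U := Ioo 0 b) (t := t) (B := B)
    (G := fun r x => G r x l j)
    (G' := fun r x => 1 / (P.tau * ε ^ 2)
        * (∑ k, P.linMat l j k * ∑ m, G r x m k + N r x l j - G r x l j)
      - ∑ i, velocity P ε l i * partialDeriv i (fun y => G r y l j) x)
    (Ioo_mem_nhds ht.1 ht.2) (fun r hr => (h.memHs r (hIoo hr) l j).1)
    ((continuous_const.mul ((hwc.add hNc).sub (hGc l j))).sub hvc)
    (fun r hr x => by rw [← heq]; exact hB r (hIoo hr) x)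
    (fun r hr x => by rw [← heq]; exact h.equation r hr x l j) n
  refine hd.congr_deriv ?_
  have hwN : Continuous fun x => ∑ k, P.linMat l j k * ∑ m, G t x m k + N t x l j := hwc.add hNc
  have hH : Continuous fun x => ∑ k, P.linMat l j k * ∑ m, G t x m k + N t x l j - G t x l j :=
    hwN.sub (hGc l j)
  have hH' : Continuous fun x => 1 / (P.tau * ε ^ 2)
      * (∑ k, P.linMat l j k * ∑ m, G t x m k + N t x l j - G t x l j) := continuous_const.mul hH
  rw [fourierCoef_sub hH' hvc, fourierCoef_const_mul, fourierCoef_sub hwN (hGc l j),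
    fourierCoef_add hwc hNc,
    fourierCoef_sum (f := fun i x => velocity P ε l i * partialDeriv i (fun y => G t y l j) x) _
      fun i => continuous_const.mul (hC1.continuous_partialDeriv i),
    fourierCoef_sum (f := fun k x => P.linMat l j k * ∑ m, G t x m k) _
      fun k => continuous_const.mul (continuous_finsetSum _ fun m _ => hGc m k)]
  simp only [fourierCoef_const_mul, fourierCoef_sum _ fun m => hGc m _,
    fourierCoef_partialDeriv hC1]
  congr 1
  push_cast
  rw [Finset.sum_mul, Finset.sum_mul]
  refine Finset.sum_congr rfl fun i _ => ?_
  ring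

/-- The entropy of the `n`-th Fourier mode. -/
noncomputable def modeEntropy (P : Params) (G : Torus → Fin 5 → Fin 3 → ℝ) (n : Fin 2 → ℤ) : ℝ :=
  P.entropyForm (fun l j => (fourierCoef (fun x => G x l j) n).re)
      (fun l j => (fourierCoef (fun x => G x l j) n).re)
    + P.entropyForm (fun l j => (fourierCoef (fun x => G x l j) n).im)
      (fun l j => (fourierCoef (fun x => G x l j) n).im)

theorem sum_sq_re_add_im (Z : Fin 5 → Fin 3 → ℂ) :
    ∑ l, ∑ j, (Z l j).re ^ 2 + ∑ l, ∑ j, (Z l j).im ^ 2 = ∑ l, ∑ j, ‖Z l j‖ ^ 2 := by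
  simp only [← Finset.sum_add_distrib]
  refine Finset.sum_congr rfl fun l _ => Finset.sum_congr rfl fun j _ => ?_
  rw [Complex.sq_norm, Complex.normSq_apply]
  ring

theorem modeEntropy_bounds (hP : P.Subcharacteristic) (G : Torus → Fin 5 → Fin 3 → ℝ)
    (n : Fin 2 → ℤ) :
    ∑ l, ∑ j, ‖fourierCoef (fun x => G x l j) n‖ ^ 2 ≤ modeEntropy P G n ∧
      modeEntropy P G n
        ≤ P.invBound * ∑ l, ∑ j, ‖fourierCoef (fun x => G x l j) n‖ ^ 2 := by
  rw [← sum_sq_re_add_im fun l j => fourierCoef (fun x => G x l j) n, mul_add]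
  exact ⟨add_le_add (hP.entropyForm_bounds _).1 (hP.entropyForm_bounds _).1,
    add_le_add (hP.entropyForm_bounds _).2 (hP.entropyForm_bounds _).2⟩

theorem hasDerivAt_modeEntropy (h : IsKineticFlow P ε s b G N) (hP : P.Subcharacteristic)
    (hτ : 0 ≤ P.tau) (hs : 2 < s) {t : ℝ} (ht : t ∈ Ioo 0 b) (n : Fin 2 → ℤ) :
    ∃ d, HasDerivAt (fun r => modeEntropy P (G r) n) d t ∧
      d ≤ 1 / (P.tau * ε ^ 2) / 2 * P.invBound
        * ∑ l, ∑ j, ‖fourierCoef (fun x => N t x l j) n‖ ^ 2 := by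
  have htI := Ioo_subset_Icc_self ht
  have hN0 : ∀ j, ∑ l, fourierCoef (fun x => N t x l j) n = 0 := fun j => by
    rw [← fourierCoef_sum _ fun l => (h.memHs_source t htI l j).1]
    have h0 : (fun x => ∑ l, N t x l j) = fun _ => 0 := by
      ext x
      have := congrFun (h.sum_source t htI x) j
      rwa [Finset.sum_apply] at this
    rw [h0, fourierCoef_const]
    simp
  rw [← sum_sq_re_add_im]
  refine hP.hasDerivAt_entropy_mode
    (X := fun r l j => (fourierCoef (fun x => G r x l j) n).re)
    (Y := fun r l j => (fourierCoef (fun x => G r x l j) n).im)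
    (N := fun l j => (fourierCoef (fun x => N t x l j) n).re)
    (R := fun l j => (fourierCoef (fun x => N t x l j) n).im)
    (θ := fun l => ∑ i, velocity P ε l i * (2 * Real.pi * n i)) (by positivity) ?_ ?_ ?_ ?_
  · ext j
    have := congrArg Complex.re (hN0 j)
    simpa [Finset.sum_apply] using this
  · ext j
    have := congrArg Complex.im (hN0 j)
    simpa [Finset.sum_apply] using this
  · intro l j
    refine (Complex.reCLM.hasFDerivAt.comp_hasDerivAt t (h.hasDerivAt_mode hs ht l j n)).congr_deriv
      ?_
    simp only [Complex.reCLM_apply, Complex.sub_re, Complex.re_ofReal_mul, Complex.add_re,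
      Complex.re_sum, mul_assoc, Complex.I_mul_re, Pi.add_apply, Pi.sub_apply, Matrix.mulVec,
      dotProduct, Finset.sum_apply]
    ring
  · intro l j
    refine (Complex.imCLM.hasFDerivAt.comp_hasDerivAt t (h.hasDerivAt_mode hs ht l j n)).congr_deriv
      ?_
    simp only [Complex.imCLM_apply, Complex.sub_im, Complex.im_ofReal_mul, Complex.add_im,
      Complex.im_sum, mul_assoc, Complex.I_mul_im, Pi.add_apply, Pi.sub_apply, Matrix.mulVec,
      dotProduct, Finset.sum_apply]

theorem continuousOn_modeEntropy (h : IsKineticFlow P ε s b G N) (n : Fin 2 → ℤ) :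
    ContinuousOn (fun r => modeEntropy P (G r) n) (Icc 0 b) := by
  have hre : ∀ l j, ContinuousOn (fun r => (fourierCoef (fun x => G r x l j) n).re) (Icc 0 b) :=
    fun l j => Complex.continuous_re.comp_continuousOn (h.continuousOn_mode l j n)
  have him : ∀ l j, ContinuousOn (fun r => (fourierCoef (fun x => G r x l j) n).im) (Icc 0 b) :=
    fun l j => Complex.continuous_im.comp_continuousOn (h.continuousOn_mode l j n)
  unfold modeEntropy Params.entropyForm
  simp only [dotProduct, Matrix.mulVec]
  exact (continuousOn_finsetSum _ fun l _ => continuousOn_finsetSum _ fun j _ =>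
      (hre l j).mul (continuousOn_finsetSum _ fun k _ => continuousOn_const.mul (hre l k))).add
    (continuousOn_finsetSum _ fun l _ => continuousOn_finsetSum _ fun j _ =>
      (him l j).mul (continuousOn_finsetSum _ fun k _ => continuousOn_const.mul (him l k)))

/-- One step of the Grönwall argument: an exponential bound of the energy can be improved. -/
theorem improve_bound (h : IsKineticFlow P ε s b G N) (hP : P.Subcharacteristic)
    (hτ : 0 ≤ P.tau) (hs : 2 < s) {B A M : ℝ}
    (hA : A = 1 / (P.tau * ε ^ 2) / 2 * P.invBound * B)
    (hN : ∀ r ∈ Icc 0 b, kineticNormSq s (N r) ≤ B * kineticNormSq s (G r)) (hM : 0 ≤ M)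
    (hA0 : 0 ≤ A)
    (hV : ∀ r ∈ Icc 0 b, kineticNormSq s (G r) ≤ M * Real.exp (2 * A * r)) :
    ∀ r ∈ Icc 0 b, kineticNormSq s (G r)
      ≤ (P.invBound * kineticNormSq s (G 0) + M / 2) * Real.exp (2 * A * r) := by
  intro r hr
  have h0 : (0 : ℝ) ∈ Icc 0 b := ⟨le_rfl, hr.1.trans hr.2⟩
  have hw := fun n => (sobolevWeight_pos s n).le
  have hIB := hP.invBound_nonneg
  have hκ : 0 ≤ 1 / (P.tau * ε ^ 2) / 2 * P.invBound := by positivity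
  -- Time derivatives are available only mode by mode, so every finite set S of modes is treated
  -- separately, with a bound independent of S.
  refine hasSum_le_of_sum_le (hasSum_kineticNormSq (h.memHs r hr)) fun S => ?_
  set E : ℝ → ℝ := fun q => ∑ n ∈ S, sobolevWeight s n * modeEntropy P (G q) n with hE
  -- The subtracted term has derivative A M exp(2Aq). This dominates the growth of the entropy,
  -- which is at most A times the energy, so the difference is nonincreasing.
  have hcont : ContinuousOn (fun q => E q - M / 2 * Real.exp (2 * A * q)) (Icc 0 b) := by
    refine ContinuousOn.sub (continuousOn_finsetSum _ fun n _ =>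
      continuousOn_const.mul (h.continuousOn_modeEntropy n)) ?_
    fun_prop
  have hder : ∀ q ∈ Ioo 0 b, ∃ d, HasDerivAt (fun q => E q - M / 2 * Real.exp (2 * A * q)) d q ∧
      d ≤ 0 := by
    intro q hq
    have hqI := Ioo_subset_Icc_self hq
    choose d hd hd' using fun n => h.hasDerivAt_modeEntropy hP hτ hs hq n
    have hexp : HasDerivAt (fun q => M / 2 * Real.exp (2 * A * q))
        (M / 2 * (Real.exp (2 * A * q) * (2 * A))) q := by
      have h1 : HasDerivAt (fun q : ℝ => 2 * A * q) (2 * A) q := by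
        simpa using (hasDerivAt_id q).const_mul (2 * A)
      exact h1.exp.const_mul _
    refine ⟨_, (HasDerivAt.fun_sum fun n _ => (hd n).const_mul (sobolevWeight s n)).sub hexp, ?_⟩
    have h1 : ∑ n ∈ S, sobolevWeight s n * d n
        ≤ 1 / (P.tau * ε ^ 2) / 2 * P.invBound * kineticNormSq s (N q) := by
      calc ∑ n ∈ S, sobolevWeight s n * d n
          ≤ ∑ n ∈ S, 1 / (P.tau * ε ^ 2) / 2 * P.invBound * (sobolevWeight s n
              * ∑ l, ∑ j, ‖fourierCoef (fun x => N q x l j) n‖ ^ 2) := by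
            refine Finset.sum_le_sum fun n _ => ?_
            refine (mul_le_mul_of_nonneg_left (hd' n) (hw n)).trans (le_of_eq ?_)
            ring
        _ ≤ _ := by
            rw [← Finset.mul_sum]
            refine mul_le_mul_of_nonneg_left ?_ hκ
            exact sum_le_hasSum S (fun n _ => mul_nonneg (hw n) (Finset.sum_nonneg fun _ _ =>
              Finset.sum_nonneg fun _ _ => sq_nonneg _)) (hasSum_kineticNormSq (h.memHs_source q hqI))
    have h2 := mul_le_mul_of_nonneg_left (hN q hqI) hκ
    have h3 := mul_le_mul_of_nonneg_left (hV q hqI) hA0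
    have h4 : 1 / (P.tau * ε ^ 2) / 2 * P.invBound * (B * kineticNormSq s (G q))
        = A * kineticNormSq s (G q) := by rw [hA]; ring
    linarith
  have hanti : AntitoneOn (fun q => E q - M / 2 * Real.exp (2 * A * q)) (Icc 0 b) := by
    refine antitoneOn_of_deriv_nonpos (convex_Icc 0 b) hcont ?_ ?_ <;> rw [interior_Icc]
    · intro q hq
      obtain ⟨d, hd, -⟩ := hder q hq
      exact hd.differentiableAt.differentiableWithinAt
    · intro q hq
      obtain ⟨d, hd, hd0⟩ := hder q hq
      rwa [hd.deriv]
  have h5 := hanti h0 hr hr.1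
  simp only [mul_zero, Real.exp_zero, mul_one] at h5
  have h6 : E 0 ≤ P.invBound * kineticNormSq s (G 0) := by
    calc E 0 ≤ ∑ n ∈ S, P.invBound * (sobolevWeight s n
            * ∑ l, ∑ j, ‖fourierCoef (fun x => G 0 x l j) n‖ ^ 2) := by
          refine Finset.sum_le_sum fun n _ => ?_
          refine (mul_le_mul_of_nonneg_left (modeEntropy_bounds hP (G 0) n).2 (hw n)).trans
            (le_of_eq ?_)
          ring
      _ ≤ _ := by
          rw [← Finset.mul_sum]
          refine mul_le_mul_of_nonneg_left ?_ hIB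
          exact sum_le_hasSum S (fun n _ => mul_nonneg (hw n) (Finset.sum_nonneg fun _ _ =>
            Finset.sum_nonneg fun _ _ => sq_nonneg _)) (hasSum_kineticNormSq (h.memHs 0 h0))
  have h7 : ∑ n ∈ S, sobolevWeight s n * ∑ l, ∑ j, ‖fourierCoef (fun x => G r x l j) n‖ ^ 2
      ≤ E r := Finset.sum_le_sum fun n _ =>
    mul_le_mul_of_nonneg_left (modeEntropy_bounds hP (G r) n).1 (hw n)
  have h8 : 1 ≤ Real.exp (2 * A * r) := Real.one_le_exp (mul_nonneg (by linarith) hr.1)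
  have h9 : 0 ≤ P.invBound * kineticNormSq s (G 0) := mul_nonneg hIB (kineticNormSq_nonneg _ _)
  nlinarith [mul_le_mul_of_nonneg_left h8 h9]

/-- Grönwall without using continuity in time of the full norm. Let M be the supremum of the energy
times exp(-2Ar), finite by boundedness. `improve_bound` gives M ≤ `invBound` · (initial energy) +
M/2, and M/2 is absorbed; the rate 2A instead of A is what produces the half. -/
theorem energy_estimate (h : IsKineticFlow P ε s b G N) (hP : P.Subcharacteristic)
    (hτ : 0 ≤ P.tau) (hs : 2 < s) (hb : 0 ≤ b) {B A : ℝ} (hB : 0 ≤ B)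
    (hA : A = 1 / (P.tau * ε ^ 2) / 2 * P.invBound * B)
    (hN : ∀ r ∈ Icc 0 b, kineticNormSq s (N r) ≤ B * kineticNormSq s (G r)) :
    kineticNormSq s (G b) ≤ 2 * P.invBound * kineticNormSq s (G 0) * Real.exp (2 * A * b) := by
  have hA0 : 0 ≤ A := by
    have := hP.invBound_nonneg
    rw [hA]; positivity
  obtain ⟨K, hK⟩ := h.bounded
  set V : ℝ → ℝ := fun r => kineticNormSq s (G r) * Real.exp (-(2 * A * r)) with hV
  have hVexp : ∀ r, kineticNormSq s (G r) = V r * Real.exp (2 * A * r) := fun r => by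
    rw [hV]; simp only
    rw [mul_assoc, ← Real.exp_add, neg_add_cancel, Real.exp_zero, mul_one]
  have hne : (V '' Icc 0 b).Nonempty := ⟨V 0, 0, ⟨le_rfl, hb⟩, rfl⟩
  have hbdd : BddAbove (V '' Icc 0 b) := by
    refine ⟨15 * K, ?_⟩
    rintro _ ⟨r, hr, rfl⟩
    have h1 : Real.exp (-(2 * A * r)) ≤ 1 :=
      Real.exp_le_one_iff.2 (neg_nonpos.2 (mul_nonneg (by linarith) hr.1))
    have h2 := kineticNormSq_nonneg s (G r)
    have h3 := kineticNormSq_le (hK r hr)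
    calc V r ≤ kineticNormSq s (G r) * 1 := mul_le_mul_of_nonneg_left h1 h2
      _ ≤ 15 * K := by linarith
  set M := sSup (V '' Icc 0 b)
  have hVM : ∀ r ∈ Icc 0 b, V r ≤ M := fun r hr => le_csSup hbdd ⟨r, hr, rfl⟩
  have hM : 0 ≤ M := le_trans (mul_nonneg (kineticNormSq_nonneg _ _) (Real.exp_pos _).le)
    (hVM 0 ⟨le_rfl, hb⟩)
  have himp := h.improve_bound hP hτ hs hA hN hM hA0 fun r hr => by
    rw [hVexp]
    exact mul_le_mul_of_nonneg_right (hVM r hr) (Real.exp_pos _).le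
  have hM2 : M ≤ P.invBound * kineticNormSq s (G 0) + M / 2 := by
    refine csSup_le hne ?_
    rintro _ ⟨r, hr, rfl⟩
    have := himp r hr
    rw [hVexp] at this
    exact le_of_mul_le_mul_right this (Real.exp_pos _)
  rw [hVexp]
  refine mul_le_mul_of_nonneg_right ?_ (Real.exp_pos _).le
  linarith [hVM b ⟨hb, le_rfl⟩]

end IsKineticFlow

end VectorBGK

namespace VectorBGK

open scoped Topology

open Set Matrix

/-! ### Structure of the Maxwellians -/

section Maxwellian

variable {P : Params}

/-- The quadratic part of the Maxwellians at the reference state. -/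
noncomputable def quadFlux (P : Params) (W : Fin 3 → ℝ) : Fin 5 → Fin 3 → ℝ :=
  ![P.kappa • ![0, W 1 * W 1 / W 0, W 1 * W 2 / W 0],
    P.kappa • ![0, W 1 * W 2 / W 0, W 2 * W 2 / W 0],
    -P.kappa • ![0, W 1 * W 1 / W 0, W 1 * W 2 / W 0],
    -P.kappa • ![0, W 1 * W 2 / W 0, W 2 * W 2 / W 0],
    0]

theorem sum_quadFlux (W : Fin 3 → ℝ) : ∑ l, quadFlux P W l = 0 := by
  ext j
  fin_cases j <;> simp [quadFlux, Fin.sum_univ_five]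

theorem quadFlux_eq_mul (l : Fin 5) (j : Fin 3) : ∃ (c : ℝ) (i k : Fin 2), c ^ 2 ≤ P.kappa ^ 2 ∧
    ∀ W, quadFlux P W l j = c * (W i.succ * W k.succ / W 0) := by
  have h0 : (0 : ℝ) ^ 2 ≤ P.kappa ^ 2 := by simpa using sq_nonneg P.kappa
  have h1 : (-P.kappa) ^ 2 ≤ P.kappa ^ 2 := by rw [neg_sq]
  fin_cases l <;> fin_cases j
  · exact ⟨0, 0, 0, h0, fun W => by simp [quadFlux]⟩
  · exact ⟨P.kappa, 0, 0, le_rfl, fun W => by simp [quadFlux]⟩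
  · exact ⟨P.kappa, 0, 1, le_rfl, fun W => by simp [quadFlux]⟩
  · exact ⟨0, 0, 0, h0, fun W => by simp [quadFlux]⟩
  · exact ⟨P.kappa, 0, 1, le_rfl, fun W => by simp [quadFlux]⟩
  · exact ⟨P.kappa, 1, 1, le_rfl, fun W => by simp [quadFlux]⟩
  · exact ⟨0, 0, 0, h0, fun W => by simp [quadFlux]⟩
  · exact ⟨-P.kappa, 0, 0, h1, fun W => by simp [quadFlux]⟩
  · exact ⟨-P.kappa, 0, 1, h1, fun W => by simp [quadFlux]⟩
  · exact ⟨0, 0, 0, h0, fun W => by simp [quadFlux]⟩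
  · exact ⟨-P.kappa, 0, 1, h1, fun W => by simp [quadFlux]⟩
  · exact ⟨-P.kappa, 1, 1, h1, fun W => by simp [quadFlux]⟩
  all_goals exact ⟨0, 0, 0, h0, fun W => by simp [quadFlux]⟩

/-- No Taylor remainder appears: the pressure is affine, and the only nonlinear part of the fluxes
is q_i q_k / ρ. -/
theorem fluct_maxwellian (W : Fin 3 → ℝ) (l : Fin 5) :
    fluct P (maxwellian P W) l = P.linMat l *ᵥ (W - P.wBar) + quadFlux P W l := by
  have hk : P.kappa = 1 / (2 * P.lam) := rfl
  rw [linMat_mulVec]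
  ext j
  fin_cases l <;> fin_cases j <;>
    simp [fluct, maxwellian, flux1, flux2, quadFlux, Params.wBar, hk, Matrix.vecHead,
      Matrix.vecTail] <;> ring

theorem maxwellian_sub (F : Fin 5 → Fin 3 → ℝ) (l : Fin 5) (j : Fin 3) :
    maxwellian P (moment F) l j - F l j
      = (P.linMat l *ᵥ (∑ m, fluct P F m) + quadFlux P (moment F) l - fluct P F l) j := by
  rw [sum_fluct, ← fluct_maxwellian]
  simp [fluct]

theorem moment_apply (F : Fin 5 → Fin 3 → ℝ) (j : Fin 3) : moment F j = ∑ l, F l j := by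
  rw [moment, Finset.sum_apply]

theorem moment_succ (F : Fin 5 → Fin 3 → ℝ) (i : Fin 2) :
    moment F i.succ = ∑ l, fluct P F l i.succ := by
  have := congrFun (sum_fluct (P := P) F) i.succ
  rw [Finset.sum_apply] at this
  rw [this]
  fin_cases i <;> simp [Params.wBar]

theorem vel_apply (ε : ℝ) (F : Fin 5 → Fin 3 → ℝ) (i : Fin 2) :
    vel ε F i = ε⁻¹ * (moment F i.succ * (density F)⁻¹) := by
  fin_cases i <;> simp [vel, div_eq_mul_inv] <;> ring

/-- One momentum is turned into ε u_i and becomes a coefficient; the other stays as a factor linear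
in the fluctuations. The squared norm thus gains ε², which offsets the stiff relaxation rate. -/
theorem quadFlux_moment {ε : ℝ} (hε : ε ≠ 0) (l : Fin 5) (j : Fin 3) :
    ∃ (c : ℝ) (i k : Fin 2), c ^ 2 ≤ P.kappa ^ 2 ∧
      ∀ F, quadFlux P (moment F) l j = c * ε * (vel ε F i * moment F k.succ) := by
  obtain ⟨c, i, k, hc, h⟩ := quadFlux_eq_mul (P := P) l j
  refine ⟨c, i, k, hc, fun F => ?_⟩
  rw [h, vel_apply, density]
  field_simp

theorem Params.Subcharacteristic.sq_linMat_le (h : P.Subcharacteristic) (l : Fin 5)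
    (j k : Fin 3) : P.linMat l j k ^ 2 ≤ 1 := by
  have h1 := h.kappa_pos
  have h2 := h.kappa_lt
  have h3 := h.a_lt
  rw [sq_le_one_iff_abs_le_one, abs_le]
  fin_cases l <;> fin_cases j <;> fin_cases k <;> simp [Params.linMat] <;>
    constructor <;> linarith

end Maxwellian

/-! ### Sums of functions in Sobolev spaces -/

/-- The constant comes from iterating ‖f + g‖² ≤ 2‖f‖² + 2‖g‖². For five terms it is 32, whence 160
= 32 · 5 and 256 = 32 · 8 below. -/
theorem hsNormSq_sum_le {s : ℝ} {ι : Type*} (t : Finset ι) {f : ι → Torus → ℝ}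
    (hf : ∀ i, MemHs s (f i)) :
    hsNormSq s (fun x => ∑ i ∈ t, f i x) ≤ 2 ^ t.card * ∑ i ∈ t, hsNormSq s (f i) := by
  classical
  induction t using Finset.induction_on with
  | empty => simp [hsNormSq, fourierCoef_const]
  | insert i t hi ih =>
    simp only [Finset.sum_insert hi, Finset.card_insert_of_notMem hi]
    refine ((hf i).add_and_le (MemHs.sum t fun j _ => hf j)).2.trans ?_
    have h1 := hsNormSq_nonneg s (f i)
    have h2 : (1 : ℝ) ≤ 2 ^ t.card := one_le_pow₀ (by norm_num)
    rw [pow_succ]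
    nlinarith

theorem hsNormSq_sum_component_le {s : ℝ} {G : Torus → Fin 5 → Fin 3 → ℝ}
    (hG : ∀ l j, MemHs s fun x => G x l j) (j : Fin 3) :
    hsNormSq s (fun x => ∑ l, G x l j) ≤ 160 * kineticNormSq s G := by
  refine (hsNormSq_sum_le Finset.univ fun l => hG l j).trans ?_
  have h := Finset.sum_le_sum fun l (_ : l ∈ Finset.univ) => hsNormSq_le_kinetic s G l j
  simp only [Finset.sum_const, Finset.card_univ, Fintype.card_fin, nsmul_eq_mul] at h ⊢
  norm_num at h ⊢
  linarith

theorem memHs_comb {s : ℝ} {G : Torus → Fin 5 → Fin 3 → ℝ}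
    (hG : ∀ l j, MemHs s fun x => G x l j) (c : Fin 5 → Fin 3 → ℝ) :
    MemHs s (fun x => ∑ l, ∑ k, c l k * G x l k) ∧
    hsNormSq s (fun x => ∑ l, ∑ k, c l k * G x l k)
      ≤ 256 * (∑ l, ∑ k, c l k ^ 2) * kineticNormSq s G := by
  have h1 : ∀ l, MemHs s fun x => ∑ k, c l k * G x l k := fun l =>
    MemHs.sum _ fun k _ => (hG l k).const_mul _
  refine ⟨MemHs.sum _ fun l _ => h1 l, (hsNormSq_sum_le Finset.univ h1).trans ?_⟩
  have h2 : ∀ l, hsNormSq s (fun x => ∑ k, c l k * G x l k)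
      ≤ 8 * ((∑ k, c l k ^ 2) * kineticNormSq s G) := fun l => by
    refine (hsNormSq_sum_le Finset.univ fun k => (hG l k).const_mul (c l k)).trans ?_
    simp only [hsNormSq_const_mul, Finset.card_univ, Fintype.card_fin, Finset.sum_mul]
    norm_num
    exact Finset.sum_le_sum fun k _ =>
      mul_le_mul_of_nonneg_left (hsNormSq_le_kinetic s G l k) (sq_nonneg _)
  have h3 := Finset.sum_le_sum fun l (_ : l ∈ Finset.univ) => h2 l
  rw [← Finset.mul_sum, ← Finset.sum_mul] at h3
  simp only [Finset.card_univ, Fintype.card_fin]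
  linarith

theorem hsNormSqVec_eq {k : ℕ} (s : ℝ) (v : Torus → Fin k → ℝ) :
    hsNormSqVec s v = ∑ j, hsNormSq s fun x => v x j := rfl

/-! ### Local boundedness in time -/

theorem exists_bound_of_local {b : ℝ} {φ : ℝ → ℝ}
    (h : ∀ t ∈ Icc 0 b, ∃ B, ∀ᶠ r in 𝓝[Icc 0 b] t, φ r ≤ B) : ∃ B, ∀ r ∈ Icc 0 b, φ r ≤ B := by
  refine isCompact_Icc.induction_on (p := fun S => ∃ B, ∀ r ∈ S, φ r ≤ B) ⟨0, by simp⟩ ?_ ?_ ?_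
  · rintro S S' hS ⟨B, hB⟩
    exact ⟨B, fun r hr => hB r (hS hr)⟩
  · rintro S S' ⟨B, hB⟩ ⟨B', hB'⟩
    refine ⟨max B B', ?_⟩
    rintro r (hr | hr)
    · exact (hB r hr).trans (le_max_left _ _)
    · exact (hB' r hr).trans (le_max_right _ _)
  · intro t ht
    obtain ⟨B, hB⟩ := h t ht
    exact ⟨_, hB, B, fun r hr => hr⟩

/-- Near t write 1/ρ_r = 1/ρ_t - (1/ρ_r)(ρ_r - ρ_t)(1/ρ_t). When ρ_r - ρ_t is small in H^s, the last
term is absorbed on the left; compactness of [0, b] does the rest. -/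
theorem exists_bound_inv {s : ℝ} (hs : 3 < s) {b : ℝ} {ρ : ℝ → Torus → ℝ}
    (hρ : ∀ r ∈ Icc 0 b, MemHs s (ρ r)) (h0 : ∀ r ∈ Icc 0 b, ∀ x, ρ r x ≠ 0)
    (hc : ∀ t ∈ Icc 0 b, Filter.Tendsto (fun r => hsNormSq s fun x => ρ r x - ρ t x)
      (𝓝[Icc 0 b] t) (𝓝 0)) :
    ∃ B, ∀ r ∈ Icc 0 b, hsNormSq s (fun x => (ρ r x)⁻¹) ≤ B := by
  obtain ⟨C, hC0, hC⟩ := exists_mul_bound (by linarith : 1 < s)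
  refine exists_bound_of_local fun t ht => ?_
  have hinv := fun r (hr : r ∈ Icc 0 b) => (hρ r hr).inv hs (h0 r hr)
  set H := hsNormSq s fun x => (ρ t x)⁻¹
  have hH : 0 ≤ H := hsNormSq_nonneg _ _
  refine ⟨4 * H, ?_⟩
  -- This threshold for d makes the product term 2C²hdH at most h/2, so h ≤ 2H + h/2.
  have hpos : (0 : ℝ) < 1 / (4 * (C * (C * H) + 1)) := by positivity
  filter_upwards [(hc t ht).eventually_lt_const hpos, self_mem_nhdsWithin] with r hr hrI
  set d := hsNormSq s fun x => ρ r x - ρ t x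
  have hd : 0 ≤ d := hsNormSq_nonneg _ _
  have h1 := hC _ _ ((hρ r hrI).sub (hρ t ht)) (hinv t ht)
  have h2 := hC _ _ (hinv r hrI) h1.1
  have h3 := hsNormSq_sub_le (hinv t ht) h2.1
  have heq : (fun x => (ρ t x)⁻¹ - (ρ r x)⁻¹ * ((ρ r x - ρ t x) * (ρ t x)⁻¹))
      = fun x => (ρ r x)⁻¹ := by
    ext x
    have := h0 r hrI x
    have := h0 t ht x
    field_simp
    ring
  rw [heq] at h3
  set h := hsNormSq s fun x => (ρ r x)⁻¹
  have hh : 0 ≤ h := hsNormSq_nonneg _ _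
  rw [lt_div_iff₀ (by positivity)] at hr
  have h4 : C * (h * hsNormSq s fun x => (ρ r x - ρ t x) * (ρ t x)⁻¹) ≤ C * (h * (C * (d * H))) :=
    mul_le_mul_of_nonneg_left (mul_le_mul_of_nonneg_left h1.2 hh) hC0
  have h5 : h * (d * (4 * (C * (C * H) + 1))) ≤ h * 1 := mul_le_mul_of_nonneg_left hr.le hh
  have h6 : 0 ≤ h * d := mul_nonneg hh hd
  nlinarith

/-! ### Solutions of the vector BGK system -/

namespace IsSolution

variable {P : Params} {ε s : ℝ} {u₀ : Torus → Fin 2 → ℝ} {T : EReal}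
  {f : ℝ → Torus → Fin 5 → Fin 3 → ℝ} {b : ℝ}

theorem Icc_subset (hb : b ∈ timeInterval T) : Icc 0 b ⊆ timeInterval T := fun _ hr =>
  ⟨hr.1, lt_of_le_of_lt (EReal.coe_le_coe_iff.2 hr.2) hb.2⟩

theorem tendsto_hsNormSq (h : IsSolution P ε s u₀ T f) (hb : b ∈ timeInterval T) {t : ℝ}
    (ht : t ∈ Icc 0 b) (l : Fin 5) (j : Fin 3) :
    Filter.Tendsto (fun r => hsNormSq s fun x => f r x l j - f t x l j) (𝓝[Icc 0 b] t) (𝓝 0) := by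
  have h1 := ((h.continuous t (Icc_subset hb ht) l).mono_left
    (nhdsWithin_mono t (Icc_subset hb))).pow 2
  rw [zero_pow two_ne_zero] at h1
  refine tendsto_of_tendsto_of_tendsto_of_le_of_le tendsto_const_nhds h1
    (fun r => hsNormSq_nonneg _ _) fun r => ?_
  simp only
  rw [sq_hsNormVec]
  exact hsNormSq_le_vec s (fun x => f r x l - f t x l) j

theorem exists_bound (h : IsSolution P ε s u₀ T f) (hb : b ∈ timeInterval T) (l : Fin 5)
    (j : Fin 3) : ∃ B, ∀ r ∈ Icc 0 b, hsNormSq s (fun x => f r x l j) ≤ B := by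
  refine exists_bound_of_local fun t ht => ?_
  refine ⟨2 * 1 + 2 * hsNormSq s fun x => f t x l j, ?_⟩
  filter_upwards [(h.tendsto_hsNormSq hb ht l j).eventually_lt_const one_pos,
    self_mem_nhdsWithin] with r hr hrI
  have h1 := h.memHs r (Icc_subset hb hrI) l j
  have h2 := h.memHs t (Icc_subset hb ht) l j
  have h3 := ((h1.sub h2).add_and_le h2).2
  simp only [sub_add_cancel] at h3
  linarith

theorem memHs_moment (h : IsSolution P ε s u₀ T f) (hb : b ∈ timeInterval T) {r : ℝ}
    (hr : r ∈ Icc 0 b) (j : Fin 3) : MemHs s fun x => moment (f r x) j := by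
  simp only [moment_apply]
  exact MemHs.sum _ fun l _ => h.memHs r (Icc_subset hb hr) l j

theorem tendsto_moment (h : IsSolution P ε s u₀ T f) (hb : b ∈ timeInterval T) {t : ℝ}
    (ht : t ∈ Icc 0 b) (j : Fin 3) :
    Filter.Tendsto (fun r => hsNormSq s fun x => moment (f r x) j - moment (f t x) j)
      (𝓝[Icc 0 b] t) (𝓝 0) := by
  have h1 : Filter.Tendsto (fun r => 2 ^ (Finset.univ : Finset (Fin 5)).card *
      ∑ l, hsNormSq s fun x => f r x l j - f t x l j) (𝓝[Icc 0 b] t) (𝓝 0) := by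
    have := (tendsto_finsetSum Finset.univ fun l _ => h.tendsto_hsNormSq hb ht l j).const_mul
      ((2 : ℝ) ^ (Finset.univ : Finset (Fin 5)).card)
    simpa using this
  refine tendsto_of_tendsto_of_tendsto_of_le_of_le' tendsto_const_nhds h1
    (.of_forall fun r => hsNormSq_nonneg _ _) ?_
  filter_upwards [self_mem_nhdsWithin] with r hr
  simp only [moment_apply, ← Finset.sum_sub_distrib]
  exact hsNormSq_sum_le _ fun l =>
    (h.memHs r (Icc_subset hb hr) l j).sub (h.memHs t (Icc_subset hb ht) l j)

theorem memHs_density_inv (h : IsSolution P ε s u₀ T f) (hs : 3 < s) (hb : b ∈ timeInterval T)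
    {r : ℝ} (hr : r ∈ Icc 0 b) : MemHs s fun x => (density (f r x))⁻¹ :=
  (h.memHs_moment hb hr 0).inv hs fun x => (h.density_pos r (Icc_subset hb hr) x).ne'

theorem memHs_vel (h : IsSolution P ε s u₀ T f) (hs : 3 < s) (hb : b ∈ timeInterval T)
    {r : ℝ} (hr : r ∈ Icc 0 b) : MemHsVec s fun x => vel ε (f r x) := fun i => by
  simp only [vel_apply]
  exact ((h.memHs_moment hb hr i.succ).mul (by linarith) (h.memHs_density_inv hs hb hr)).const_mul _

theorem exists_bound_moment (h : IsSolution P ε s u₀ T f) (hb : b ∈ timeInterval T) (j : Fin 3) :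
    ∃ B, ∀ r ∈ Icc 0 b, hsNormSq s (fun x => moment (f r x) j) ≤ B := by
  choose B hB using fun l => h.exists_bound hb l j
  refine ⟨2 ^ (Finset.univ : Finset (Fin 5)).card * ∑ l, B l, fun r hr => ?_⟩
  simp only [moment_apply]
  refine (hsNormSq_sum_le _ fun l => h.memHs r (Icc_subset hb hr) l j).trans ?_
  exact mul_le_mul_of_nonneg_left (Finset.sum_le_sum fun l _ => hB l r hr) (by positivity)

/-- Needed for `velSup` to be a true upper bound: the real `sSup` of an unbounded set is 0. -/
theorem bddAbove_velNorms (h : IsSolution P ε s u₀ T f) (hs : 3 < s) (hb : b ∈ timeInterval T) :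
    BddAbove (velNorms ε s f b) := by
  obtain ⟨C, hC0, hC⟩ := exists_mul_bound (by linarith : 1 < s)
  obtain ⟨D, hD⟩ := exists_bound_inv hs (ρ := fun r x => density (f r x))
    (fun r hr => h.memHs_moment hb hr 0)
    (fun r hr x => (h.density_pos r (Icc_subset hb hr) x).ne') fun t ht => h.tendsto_moment hb ht 0
  choose B hB using fun i : Fin 2 => h.exists_bound_moment hb i.succ
  refine ⟨√(∑ i, ε⁻¹ ^ 2 * (C * (B i * D))), ?_⟩
  rintro _ ⟨r, hr, rfl⟩
  refine Real.sqrt_le_sqrt (Finset.sum_le_sum fun i _ => ?_)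
  simp only [vel_apply, hsNormSq_const_mul]
  refine mul_le_mul_of_nonneg_left ?_ (sq_nonneg _)
  refine (hC _ _ (h.memHs_moment hb hr i.succ) (h.memHs_density_inv hs hb hr)).2.trans ?_
  exact mul_le_mul_of_nonneg_left (mul_le_mul (hB i r hr) (hD r hr) (hsNormSq_nonneg _ _)
    ((hsNormSq_nonneg _ _).trans (hB i r hr))) hC0

theorem hsNormSq_vel_le (h : IsSolution P ε s u₀ T f) (hs : 3 < s) (hb : b ∈ timeInterval T)
    {r : ℝ} (hr : r ∈ Icc 0 b) (i : Fin 2) :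
    hsNormSq s (fun x => vel ε (f r x) i) ≤ velSup ε s f b ^ 2 := by
  refine (hsNormSq_le_vec s (fun x => vel ε (f r x)) i).trans ?_
  rw [← sq_hsNormVec]
  exact pow_le_pow_left₀ (hsNormVec_nonneg _ _)
    (le_csSup (h.bddAbove_velNorms hs hb) ⟨r, hr, rfl⟩) 2

/-! ### The fluctuations of a solution as a linear kinetic flow. -/

theorem memHs_fluct (h : IsSolution P ε s u₀ T f) (hb : b ∈ timeInterval T)
    {r : ℝ} (hr : r ∈ Icc 0 b) (l : Fin 5) (j : Fin 3) :
    MemHs s fun x => fluct P (f r x) l j :=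
  (h.memHs r (Icc_subset hb hr) l j).sub (memHs_const s _)

theorem memHs_quadFlux (h : IsSolution P ε s u₀ T f) (hs : 3 < s) (hε : 0 < ε)
    (hb : b ∈ timeInterval T) {C : ℝ} (hC0 : 0 ≤ C)
    (hC : ∀ f g : Torus → ℝ, MemHs s f → MemHs s g → MemHs s (fun x => f x * g x) ∧
      hsNormSq s (fun x => f x * g x) ≤ C * (hsNormSq s f * hsNormSq s g))
    {r : ℝ} (hr : r ∈ Icc 0 b) (l : Fin 5) (j : Fin 3) :
    MemHs s (fun x => quadFlux P (moment (f r x)) l j) ∧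
      hsNormSq s (fun x => quadFlux P (moment (f r x)) l j) ≤ P.kappa ^ 2 * ε ^ 2 *
        (C * (velSup ε s f b ^ 2 * (160 * kineticNormSq s fun x => fluct P (f r x)))) := by
  obtain ⟨c, i, k, hc, hq⟩ := quadFlux_moment (P := P) hε.ne' l j
  have h1 := hC _ _ (h.memHs_vel hs hb hr i) (h.memHs_moment hb hr k.succ)
  simp only [hq]
  refine ⟨h1.1.const_mul _, ?_⟩
  rw [hsNormSq_const_mul, mul_pow]
  have h2 : hsNormSq s (fun x => moment (f r x) k.succ)
      ≤ 160 * kineticNormSq s fun x => fluct P (f r x) := by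
    simp only [moment_succ (P := P)]
    exact hsNormSq_sum_component_le (fun l j => h.memHs_fluct hb hr l j) k.succ
  refine mul_le_mul (mul_le_mul_of_nonneg_right hc (sq_nonneg _)) (h1.2.trans ?_)
    (hsNormSq_nonneg _ _) (by positivity)
  exact mul_le_mul_of_nonneg_left (mul_le_mul (h.hsNormSq_vel_le hs hb hr i) h2
    (hsNormSq_nonneg _ _) (sq_nonneg _)) hC0

theorem exists_bound_fluct (h : IsSolution P ε s u₀ T f) (hb : b ∈ timeInterval T) :
    ∃ B, ∀ r ∈ Icc 0 b, ∀ l j, hsNormSq s (fun x => fluct P (f r x) l j) ≤ B := by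
  choose B hB using fun l j => h.exists_bound hb l j
  set c : Fin 5 → Fin 3 → ℝ := fun l j => (![P.a, P.a, P.a, P.a, 1 - 4 * P.a] l • P.wBar) j
  obtain ⟨K, hK⟩ : ∃ K, ∀ l j, 2 * B l j + 2 * hsNormSq s (fun _ => c l j) ≤ K := by
    obtain ⟨K, hK⟩ := (Set.finite_range fun p : Fin 5 × Fin 3 =>
      2 * B p.1 p.2 + 2 * hsNormSq s (fun _ => c p.1 p.2)).bddAbove
    exact ⟨K, fun l j => hK ⟨(l, j), rfl⟩⟩
  refine ⟨K, fun r hr l j => le_trans ?_ (hK l j)⟩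
  have h1 := hsNormSq_sub_le (h.memHs r (Icc_subset hb hr) l j) (memHs_const s (c l j))
  have h2 := hB l j r hr
  have h3 : (fun x => fluct P (f r x) l j) = fun x => f r x l j - c l j := rfl
  rw [h3]
  linarith

/-- Subtracting a constant state changes no derivative. The equation is asked for only at interior
times, where the one-sided derivative is a full one. -/
theorem isKineticFlow (h : IsSolution P ε s u₀ T f) (hs : 3 < s) (hε : 0 < ε)
    (hb : b ∈ timeInterval T) :
    IsKineticFlow P ε s b (fun r x => fluct P (f r x)) fun r x => quadFlux P (moment (f r x)) := by
  obtain ⟨C, hC0, hC⟩ := exists_mul_bound (by linarith : 1 < s)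
  obtain ⟨B, hB⟩ := h.exists_bound_fluct hb
  refine ⟨fun r hr l j => h.memHs_fluct hb hr l j,
    fun r hr l j => (h.memHs_quadFlux hs hε hb hC0 hC hr l j).1, ⟨B, hB⟩, ?_,
    fun r _ x => sum_quadFlux _, ?_, ?_⟩
  · refine ⟨P.kappa ^ 2 * ε ^ 2 * (C * (velSup ε s f b ^ 2 * (160 * (15 * B)))),
      fun r hr l j => (h.memHs_quadFlux hs hε hb hC0 hC hr l j).2.trans ?_⟩
    have := kineticNormSq_le (hB r hr)
    gcongr
  · intro l j n t ht
    rw [ContinuousWithinAt, tendsto_iff_norm_sub_tendsto_zero]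
    have h1 := (h.tendsto_hsNormSq hb ht l j).sqrt
    rw [Real.sqrt_zero] at h1
    refine tendsto_of_tendsto_of_tendsto_of_le_of_le' tendsto_const_nhds h1
      (.of_forall fun r => norm_nonneg _) ?_
    filter_upwards [self_mem_nhdsWithin] with r hr
    rw [← fourierCoef_sub (h.memHs_fluct hb hr l j).1 (h.memHs_fluct hb ht l j).1]
    apply Real.le_sqrt_of_sq_le
    have h2 : (fun x => fluct P (f r x) l j - fluct P (f t x) l j)
        = fun x => f r x l j - f t x l j := by
      ext x
      simp [fluct]
    rw [h2]
    exact sq_norm_fourierCoef_le (by linarith)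
      ((h.memHs r (Icc_subset hb hr) l j).sub (h.memHs t (Icc_subset hb ht) l j)) n
  · intro r hr x l j
    have h1 := ((h.equation r (Icc_subset hb (Ioo_subset_Icc_self hr)) x l j).mono
      (Icc_subset hb)).hasDerivAt (Icc_mem_nhds hr.1 hr.2)
    have h2 : ∀ i, partialDeriv i (fun y => fluct P (f r y) l j) x
        = partialDeriv i (fun y => f r y l j) x := fun i => by
      unfold partialDeriv
      exact deriv_sub_const _
    rw [← maxwellian_sub]
    simp only [h2]
    exact h1.sub_const _

/-- The data are Maxwellians of density ρ̄, so the fluctuation is ε times a linear term in u₀ plus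
ε² times a product u_i u_k. In the quadratic term one factor ε²‖u₀‖_s² is replaced by K²; this is
how the constant comes to depend on K. -/
theorem kineticNormSq_initial_le (h : IsSolution P ε s u₀ T f) (hP : P.Subcharacteristic)
    (hρ : 0 < P.rhoBar) {C : ℝ} (hC0 : 0 ≤ C)
    (hC : ∀ f g : Torus → ℝ, MemHs s f → MemHs s g → MemHs s (fun x => f x * g x) ∧
      hsNormSq s (fun x => f x * g x) ≤ C * (hsNormSq s f * hsNormSq s g))
    (hε : 0 < ε) (hu : MemHsVec s u₀) {K : ℝ} (hK : ε * hsNormVec s u₀ ≤ K) :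
    kineticNormSq s (fun x => fluct P (f 0 x))
      ≤ 15 * ((8 * P.rhoBar ^ 2 + 2 * P.kappa ^ 2 * P.rhoBar ^ 2 * C) * (1 + K ^ 2)
        * (ε ^ 2 * hsNormSqVec s u₀)) := by
  refine kineticNormSq_le fun l j => ?_
  set V := hsNormSqVec s u₀ with hV
  have hV0 : 0 ≤ V := hsNormSqVec_nonneg _ _
  have hu' : ∀ i, hsNormSq s (fun x => u₀ x i) ≤ V := fun i => hsNormSq_le_vec s u₀ i
  obtain ⟨c, i, k, hc, hq⟩ := quadFlux_eq_mul (P := P) l j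
  have hval : (fun x => fluct P (f 0 x) l j) = fun x =>
      (ε * P.rhoBar * P.linMat l j 1 * u₀ x 0 + ε * P.rhoBar * P.linMat l j 2 * u₀ x 1)
      + c * (ε ^ 2 * P.rhoBar) * (u₀ x i * u₀ x k) := by
    ext x
    have h0 : f 0 x = maxwellian P ![P.rhoBar, ε * P.rhoBar * u₀ x 0, ε * P.rhoBar * u₀ x 1] :=
      funext fun l => h.initial x l
    have hW : ∀ i : Fin 2, (![P.rhoBar, ε * P.rhoBar * u₀ x 0, ε * P.rhoBar * u₀ x 1] :
        Fin 3 → ℝ) i.succ = ε * P.rhoBar * u₀ x i := fun i => by fin_cases i <;> rfl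
    rw [h0, fluct_maxwellian, Pi.add_apply, hq, hW, hW, Matrix.mulVec, dotProduct,
      Fin.sum_univ_three]
    simp [Params.wBar]
    field_simp
  have m0 := (hu 0).const_mul (ε * P.rhoBar * P.linMat l j 1)
  have m1 := (hu 1).const_mul (ε * P.rhoBar * P.linMat l j 2)
  have mq := hC _ _ (hu i) (hu k)
  have a1 := m0.add_and_le m1
  have a2 := (a1.1.add_and_le (mq.1.const_mul (c * (ε ^ 2 * P.rhoBar)))).2
  rw [hval]
  simp only [hsNormSq_const_mul] at a1 a2
  have b0 : (ε * P.rhoBar * P.linMat l j 1) ^ 2 * hsNormSq s (fun x => u₀ x 0)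
      ≤ ε ^ 2 * P.rhoBar ^ 2 * V := by
    rw [mul_pow, mul_pow]
    exact mul_le_mul (mul_le_of_le_one_right (by positivity) (hP.sq_linMat_le l j 1)) (hu' 0)
      (hsNormSq_nonneg _ _) (by positivity)
  have b1 : (ε * P.rhoBar * P.linMat l j 2) ^ 2 * hsNormSq s (fun x => u₀ x 1)
      ≤ ε ^ 2 * P.rhoBar ^ 2 * V := by
    rw [mul_pow, mul_pow]
    exact mul_le_mul (mul_le_of_le_one_right (by positivity) (hP.sq_linMat_le l j 2)) (hu' 1)
      (hsNormSq_nonneg _ _) (by positivity)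
  have hKV : ε ^ 2 * V ≤ K ^ 2 := by
    rw [hV, ← sq_hsNormVec, ← mul_pow]
    exact pow_le_pow_left₀ (mul_nonneg hε.le (hsNormVec_nonneg _ _)) hK 2
  have b2 : (c * (ε ^ 2 * P.rhoBar)) ^ 2 * hsNormSq s (fun x => u₀ x i * u₀ x k)
      ≤ P.kappa ^ 2 * P.rhoBar ^ 2 * C * (K ^ 2 * (ε ^ 2 * V)) := by
    calc _ ≤ (P.kappa ^ 2 * (ε ^ 2 * P.rhoBar) ^ 2) * (C * (V * V)) := by
          rw [mul_pow]
          refine mul_le_mul (mul_le_mul_of_nonneg_right hc (sq_nonneg _)) (mq.2.trans ?_)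
            (hsNormSq_nonneg _ _) (by positivity)
          exact mul_le_mul_of_nonneg_left (mul_le_mul (hu' i) (hu' k) (hsNormSq_nonneg _ _) hV0) hC0
      _ = P.kappa ^ 2 * P.rhoBar ^ 2 * C * ((ε ^ 2 * V) * (ε ^ 2 * V)) := by ring
      _ ≤ _ := by gcongr
  -- Nonnegative cross terms, added when the bound is written as a product with 1 + K².
  have b3 : 0 ≤ P.rhoBar ^ 2 * (K ^ 2 * (ε ^ 2 * V)) := by positivity
  have b4 : 0 ≤ P.kappa ^ 2 * P.rhoBar ^ 2 * C * (ε ^ 2 * V) := by positivity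
  linarith [a1.2]

end IsSolution

end VectorBGK

namespace VectorBGK

open scoped Topology

open Set Matrix

/-! ### Bounds for the symmetrized variables -/

section Dual

variable {P : Params}

/-- The powers of `ε` in the components of `dualState`. -/
def dualWeight : Fin 5 → ℕ := ![0, 1, 1, 2, 2]

/-- Each component depends on ε only through one power; the coefficients c are free of ε, which
makes the later bounds uniform. -/
theorem dualState_component (i : Fin 5) (j : Fin 3) : ∃ c : Fin 5 → Fin 3 → ℝ,
    ∀ (ε : ℝ) (G : Fin 5 → Fin 3 → ℝ),
    dualState P ε (fun l => P.invMat l *ᵥ G l) (i, j)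
      = ε⁻¹ ^ dualWeight i * ∑ l, ∑ k, c l k * G l k := by
  obtain ⟨d, hd⟩ : ∃ d : Fin 5 → ℝ, ∀ ε y, dualState P ε y (i, j)
      = ε⁻¹ ^ dualWeight i * ∑ l, d l * y l j := by
    fin_cases i
    · exact ⟨![0, 0, 0, 0, 1], fun ε y => by simp [dualState, dualWeight, Fin.sum_univ_five]⟩
    · exact ⟨![1 / (2 * P.lam), 0, -(1 / (2 * P.lam)), 0, 0], fun ε y => by
        simp [dualState, dualWeight, Fin.sum_univ_five]; ring⟩
    · exact ⟨![0, 1 / (2 * P.lam), 0, -(1 / (2 * P.lam)), 0], fun ε y => by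
        simp [dualState, dualWeight, Fin.sum_univ_five]; ring⟩
    · exact ⟨![1 / 2, 0, 1 / 2, 0, -1], fun ε y => by
        simp [dualState, dualWeight, Fin.sum_univ_five]; ring⟩
    · exact ⟨![0, 1 / 2, 0, 1 / 2, -1], fun ε y => by
        simp [dualState, dualWeight, Fin.sum_univ_five]; ring⟩
  refine ⟨fun l k => d l * P.invMat l j k, fun ε G => ?_⟩
  rw [hd]
  simp only [Matrix.mulVec, dotProduct, Finset.mul_sum, mul_assoc]

theorem exists_dualState_bound : ∃ C : ℝ, 0 ≤ C ∧ ∀ (s ε : ℝ) (G : Torus → Fin 5 → Fin 3 → ℝ),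
    ε ≠ 0 → (∀ l j, MemHs s fun x => G x l j) → ∀ i j,
      ε ^ (2 * dualWeight i) * hsNormSq s
        (fun x => dualState P ε (fun l => P.invMat l *ᵥ G x l) (i, j)) ≤ C * kineticNormSq s G := by
  choose c hc using fun i j => dualState_component (P := P) i j
  refine ⟨∑ i, ∑ j, 256 * ∑ l, ∑ k, c i j l k ^ 2, by positivity, fun s ε G hε hG i j => ?_⟩
  simp only [hc, hsNormSq_const_mul]
  rw [← mul_assoc, ← pow_mul, inv_pow, mul_comm (dualWeight i) 2, mul_inv_cancel₀ (pow_ne_zero _ hε),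
    one_mul]
  refine (memHs_comb hG (c i j)).2.trans (mul_le_mul_of_nonneg_right ?_ (kineticNormSq_nonneg _ _))
  refine (Finset.single_le_sum (f := fun j => 256 * ∑ l, ∑ k, c i j l k ^ 2)
    (fun _ _ => by positivity) (Finset.mem_univ j)).trans ?_
  exact Finset.single_le_sum (f := fun i => ∑ j, 256 * ∑ l, ∑ k, c i j l k ^ 2)
    (fun _ _ => by positivity) (Finset.mem_univ i)

/-- The weighted norms of the symmetrized variables are controlled by those of the fluctuations. -/
theorem exists_symState_bound (h : P.Subcharacteristic) (hl : P.lam ≠ 0) :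
    ∃ C : ℝ, 0 ≤ C ∧ ∀ (s ε : ℝ) (F : Torus → Fin 5 → Fin 3 → ℝ), ε ≠ 0 →
      (∀ l j, MemHs s fun x => fluct P (F x) l j) → ∀ i : Fin 5,
        ε ^ (2 * dualWeight i + 4) * hsNormSqVec s (fun x j => symState P ε (F x) (i, j) / ε ^ 2)
          ≤ C * kineticNormSq s fun x => fluct P (F x) := by
  obtain ⟨C, hC0, hC⟩ := exists_dualState_bound (P := P)
  refine ⟨3 * C, by positivity, fun s ε F hε hF i => ?_⟩
  have key : ∀ j, ε ^ (2 * dualWeight i + 4)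
      * hsNormSq s (fun x => symState P ε (F x) (i, j) / ε ^ 2)
      ≤ C * kineticNormSq s fun x => fluct P (F x) := fun j => by
    refine le_trans (le_of_eq ?_) (hC s ε (fun x => fluct P (F x)) hε hF i j)
    simp only [(symState_eq hε hl h _).2, div_eq_inv_mul, hsNormSq_const_mul]
    field_simp
    ring
  rw [hsNormSqVec_eq, Finset.mul_sum]
  refine (Finset.sum_le_sum fun j _ => key j).trans (le_of_eq ?_)
  simp
  ring

theorem wVar_apply (ε : ℝ) (F : Fin 5 → Fin 3 → ℝ) (j : Fin 3) :
    wVar P ε F j = ∑ l, fluct P F l j := by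
  have := congrFun (sum_fluct (P := P) F) j
  rw [Finset.sum_apply] at this
  rw [this]
  rfl

theorem hsNormSqVec_wVar_le {s : ℝ} (ε : ℝ) {F : Torus → Fin 5 → Fin 3 → ℝ}
    (hF : ∀ l j, MemHs s fun x => fluct P (F x) l j) :
    hsNormSqVec s (fun x => wVar P ε (F x)) ≤ 480 * kineticNormSq s fun x => fluct P (F x) := by
  rw [hsNormSqVec_eq]
  simp only [wVar_apply]
  refine (Finset.sum_le_sum fun j _ => hsNormSq_sum_component_le hF j).trans (le_of_eq ?_)
  simp
  ring

/-- As ρu = q/ε, the left side of the second estimate is that of w divided by ε². -/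
theorem density_velocity_norm {ε : ℝ} (hε : ε ≠ 0) (s : ℝ) {F : Torus → Fin 5 → Fin 3 → ℝ}
    (hρ : ∀ x, density (F x) ≠ 0) :
    hsNormSq s (fun x => density (F x) - P.rhoBar) / ε ^ 2
      + hsNormSqVec s (fun x => density (F x) • vel ε (F x))
      = hsNormSqVec s (fun x => wVar P ε (F x)) / ε ^ 2 := by
  have h0 : (fun x => density (F x) - P.rhoBar) = fun x => wVar P ε (F x) 0 := rfl
  have h1 : ∀ i : Fin 2, (fun x => (density (F x) • vel ε (F x)) i)
      = fun x => ε⁻¹ * wVar P ε (F x) i.succ := fun i => by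
    ext x
    rw [wVar_apply, ← moment_succ, Pi.smul_apply, vel_apply, smul_eq_mul]
    have := hρ x
    field_simp
  rw [hsNormSqVec_eq, hsNormSqVec_eq s fun x => wVar P ε (F x), h0]
  simp only [h1, hsNormSq_const_mul]
  rw [Fin.sum_univ_succ (n := 2), add_div, Finset.sum_div]
  congr 1
  refine Finset.sum_congr rfl fun i _ => ?_
  field_simp

end Dual

/-! ### Grönwall bound for solutions. -/

namespace IsSolution

variable {P : Params} {ε s : ℝ} {u₀ : Torus → Fin 2 → ℝ} {T : EReal}
  {f : ℝ → Torus → Fin 5 → Fin 3 → ℝ} {b : ℝ}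

/-- Growth of the kinetic energy of a solution. -/
theorem kineticNormSq_le (h : IsSolution P ε s u₀ T f) (hP : P.Subcharacteristic)
    (hτ : 0 < P.tau) (hs : 3 < s) {C : ℝ} (hC0 : 0 ≤ C)
    (hC : ∀ f g : Torus → ℝ, MemHs s f → MemHs s g → MemHs s (fun x => f x * g x) ∧
      hsNormSq s (fun x => f x * g x) ≤ C * (hsNormSq s f * hsNormSq s g))
    (hε : 0 < ε) (hb : b ∈ timeInterval T) :
    kineticNormSq s (fun x => fluct P (f b x))
      ≤ 2 * P.invBound * kineticNormSq s (fun x => fluct P (f 0 x))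
        * Real.exp (2400 * P.invBound * P.kappa ^ 2 * C / P.tau * velSup ε s f b ^ 2 * b) := by
  -- Here 2400 = 15 · 160: fifteen components, and 160 from bounding the momentum by the
  -- fluctuations. The ε² in B cancels the one in 1/(τε²).
  have h1 := (h.isKineticFlow hs hε hb).energy_estimate hP hτ.le (by linarith) hb.1
    (B := 2400 * (P.kappa ^ 2 * ε ^ 2 * C * velSup ε s f b ^ 2)) (by positivity) rfl
    fun r hr => by
      refine (VectorBGK.kineticNormSq_le fun l j =>
        (h.memHs_quadFlux hs hε hb hC0 hC hr l j).2).trans (le_of_eq ?_)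
      ring
  convert h1 using 3
  field_simp

end IsSolution

end VectorBGK

/-! ### Conclusion: the two estimates. -/

open VectorBGK in
theorem proposition1 (P : Params) (hP : P.Pos) (hdiss : P.Dissipation) (hlam : P.LargeVelocity)
    (s : ℝ) (hs : 3 < s) :
    ∃ C : ℝ → ℝ, Monotone C ∧ (∀ r, 0 ≤ C r) ∧
      ∀ K : ℝ, ∃ c : ℝ, 0 < c ∧
        ∀ (ε : ℝ) (u₀ : Torus → Fin 2 → ℝ), 0 < ε → MemHsVec s u₀ → ε * hsNormVec s u₀ ≤ K →
        ∀ (T : EReal) (f : ℝ → Torus → Fin 5 → Fin 3 → ℝ), IsSolution P ε s u₀ T f →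
        ∀ t ∈ timeInterval T,
          -- the quantities in the estimates are well defined
          (∀ x, Matrix.mulVec (symmetrizer P ε) (symState P ε (f t x)) = state P ε (f t x)) ∧
          (∀ r ∈ Set.Icc 0 t, MemHsVec s fun x => vel ε (f r x)) ∧
          BddAbove (velNorms ε s f t) ∧
          -- the two estimates
          hsNormSqVec s (fun x => wVar P ε (f t x))
              + ε ^ 6 * (hsNormSqVec s (fun x => mTilde P ε (f t x))
                + hsNormSqVec s (fun x => xiTilde P ε (f t x)))
              + ε ^ 8 * (hsNormSqVec s (fun x => kTilde P ε (f t x))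
                + hsNormSqVec s (fun x => hTilde P ε (f t x)))
            ≤ c * ε ^ 2 * hsNormSqVec s u₀ * Real.exp (C (velSup ε s f t) * t) ∧
          hsNormSq s (fun x => density (f t x) - P.rhoBar) / ε ^ 2
              + hsNormSqVec s (fun x => density (f t x) • vel ε (f t x))
            ≤ c * hsNormSqVec s u₀ * Real.exp (C (velSup ε s f t) * t) := by
  have hS := Params.subcharacteristic hP hdiss hlam
  have hl : P.lam ≠ 0 := hP.1.ne'
  have hτ := hP.2.1
  have hI := hS.invBound_nonneg
  obtain ⟨A, hA0, hA⟩ := exists_mul_bound (by linarith : 1 < s)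
  obtain ⟨D, hD0, hD⟩ := exists_symState_bound hS hl
  -- Replacing r by max r 0 makes the square nondecreasing on all of ℝ; since `velSup` is
  -- nonnegative, its value there is unchanged.
  refine ⟨fun r => 2400 * P.invBound * P.kappa ^ 2 * A / P.tau * max r 0 ^ 2, ?_, ?_, ?_⟩
  · intro r r' hr
    have : max r 0 ≤ max r' 0 := max_le_max_right 0 hr
    have : 0 ≤ max r 0 := le_max_right _ _
    dsimp only
    gcongr
  · intro r
    positivity
  intro K
  set c₀ := 15 * ((8 * P.rhoBar ^ 2 + 2 * P.kappa ^ 2 * P.rhoBar ^ 2 * A) * (1 + K ^ 2))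
  have hc₀ : 0 ≤ c₀ := by positivity
  -- 480 controls w and D each of the four symmetrized variables; the final 1 only ensures
  -- positivity.
  refine ⟨(480 + 4 * D) * (2 * P.invBound * c₀) + 1, by positivity, ?_⟩
  intro ε u₀ hε hu hK T f hf t ht
  have htI : t ∈ Set.Icc 0 t := ⟨ht.1, le_rfl⟩
  have hvS : 0 ≤ velSup ε s f t := Real.sSup_nonneg (by
    rintro _ ⟨r, _, rfl⟩
    exact hsNormVec_nonneg _ _)
  have hbound := hf.kineticNormSq_le hS hτ hs hA0 hA hε ht
  have hinit := hf.kineticNormSq_initial_le hS hP.2.2.2 hA0 hA hε hu hK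
  have hfl : ∀ l j, MemHs s fun x => fluct P (f t x) l j := hf.memHs_fluct ht htI
  simp only [max_eq_left hvS]
  set e := Real.exp (2400 * P.invBound * P.kappa ^ 2 * A / P.tau * velSup ε s f t ^ 2 * t)
  have he : 0 < e := Real.exp_pos _
  set V := kineticNormSq s fun x => fluct P (f t x)
  set U := hsNormSqVec s u₀
  have hU : 0 ≤ U := hsNormSqVec_nonneg _ _
  have hV : V ≤ 2 * P.invBound * c₀ * (ε ^ 2 * U * e) := by
    refine hbound.trans ?_
    calc _ ≤ 2 * P.invBound * (c₀ * (ε ^ 2 * U)) * e := by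
          refine mul_le_mul_of_nonneg_right (mul_le_mul_of_nonneg_left (hinit.trans (le_of_eq ?_))
            (by positivity)) he.le
          ring
      _ = _ := by ring
  have hX : 0 ≤ ε ^ 2 * U * e := by positivity
  have hw := hsNormSqVec_wVar_le ε hfl
  have hDV : 0 ≤ D * (2 * P.invBound * c₀) := by positivity
  have hfin := mul_le_mul_of_nonneg_left hV (by positivity : 0 ≤ 480 + 4 * D)
  refine ⟨fun x => (symState_eq hε.ne' hl hS (f t x)).1, fun r hr => hf.memHs_vel hs ht hr,
    hf.bddAbove_velNorms hs ht, ?_, ?_⟩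
  -- The exponents 6 and 8 are 2 · `dualWeight` + 4, where 4 accounts for the division of the
  -- symmetrized components by ε².
  · have d1 : ε ^ 6 * hsNormSqVec s (fun x => mTilde P ε (f t x)) ≤ D * V :=
      hD s ε (f t) hε.ne' hfl 1
    have d2 : ε ^ 6 * hsNormSqVec s (fun x => xiTilde P ε (f t x)) ≤ D * V :=
      hD s ε (f t) hε.ne' hfl 2
    have d3 : ε ^ 8 * hsNormSqVec s (fun x => kTilde P ε (f t x)) ≤ D * V :=
      hD s ε (f t) hε.ne' hfl 3
    have d4 : ε ^ 8 * hsNormSqVec s (fun x => hTilde P ε (f t x)) ≤ D * V :=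
      hD s ε (f t) hε.ne' hfl 4
    linarith
  · rw [density_velocity_norm hε.ne' s fun x => (hf.density_pos t ht x).ne',
      div_le_iff₀ (by positivity)]
    have : 480 * V ≤ (480 + 4 * D) * V :=
      mul_le_mul_of_nonneg_right (by linarith) (kineticNormSq_nonneg _ _)
    linarith
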